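/- Let $G$ be a finite-dimensional real Lie group with Lie algebra $\mathfrak g$ (bracket of left-invariant vector fields), and let $X$ be a smooth (Hausdorff, finite-dimensional) manifold with a smooth local action of $G$: an open neighbourhood $\mathcal U\subset G\times X$ of $\{e\}\times X$ and a smooth map $\mathcal U\to X$, $(g,y)\mapsto g\cdot y$, with $e\cdot y=y$, and $h\cdot(g\cdot y)=(hg)\cdot y$ whenever both sides are defined. For $y\in X$ let $\pi_y:\mathfrak g\to T_yX$ be the differential at $e$ of the orbit map $g\mapsto g\cdot y$. Assume that $X$ is locally homogeneous, i.e. $\pi_y$ is surjective for every $y\in X$. Fix $x\in X$, put $\mathfrak g_x=\ker\pi_x$ and identify $T_xX=\mathfrak g/\mathfrak g_x$ by $\pi_x$. A smooth subbundle $\mathbb E\subset TX$ is called locally homogeneous if $dg_y(\mathbb E_y)=\mathbb E_{g\cdot y}$ for all $(g,y)$ in some neighbourhood of $\{e\}\times X$; it corresponds to the subspace $\mathfrak e=\pi_x^{-1}(\mathbb E_x)\subset\mathfrak g$, so that $\mathbb E_x=\mathfrak e/\mathfrak g_x$. Likewise a locally homogeneous complex subbundle $\mathbb E$ of $T^{\mathbb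 C}X=TX\otimes_{\mathbb R}\mathbb C$ corresponds to the complex subspace $\mathfrak e=(\pi_x^{\mathbb C})^{-1}(\mathbb E_x)$ of $\mathfrak g^{\mathbb C}$. Then the following hold. 1. The subspace $\mathfrak e$ corresponding to a locally homogeneous subbundle of $TX$ (resp. of $T^{\mathbb C}X$) is stable under $\operatorname{ad}(\mathfrak g_x)$ (resp. $\operatorname{ad}(\mathfrak g_x^{\mathbb C})$). 2. Let $\mathbb E^1,\mathbb E^2,\mathbb D\subset TX$ be locally homogeneous subbundles corresponding to $\mathfrak e^1,\mathfrak e^2,\mathfrak d\subset\mathfrak g$, and assume that the bracket map $$[\ ,\ ]:\Gamma(X,\mathbb E^1)\times\Gamma(X,\mathbb E^2)\to\Gamma(X,TX)/\Gamma(X,\mathbb D)$$ on smooth sections is $C^\infty(X)$-bilinear. Then there is a unique family of bilinear maps $b_y:\mathbb E^1_y\times\mathbb E^2_y\to T_yX/\mathbb D_y$, $y\in X$, with $b_y(\xi_y,\eta_y)=[\xi,\eta]_y \bmod \mathbb D_y$ for all $\xi\in\Gamma(X,\mathbb E^1)$, $\eta\in\Gamma(X,\mathbb E^2)$. Assume moreover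 that $\mathbb E^1_x$ and $\mathbb E^2_x$ are non-zero or, more generally, that if one of them is zero then the other one is contained in $\mathbb D_x$. Then, for all $\nu^1\in\mathbb E^1_x$, $\nu^2\in\mathbb E^2_x$ and all representatives $u^1\in\mathfrak e^1$, $u^2\in\mathfrak e^2$ (i.e. $\pi_x(u^j)=\nu^j$), under the identification $T_xX/\mathbb D_x=\mathfrak g/\mathfrak d$ induced by $\pi_x$, $$b_x(\nu^1,\nu^2)=[u^1,u^2]_{\mathfrak g}\bmod\mathfrak d ;$$ in particular the right-hand side does not depend on the choice of the representatives. 3. The statement in 2 also holds for locally homogeneous complex subbundles $\mathbb E^1,\mathbb E^2,\mathbb D$ of $T^{\mathbb C}X$, with $\mathfrak g^{\mathbb C}$, $\pi_x^{\mathbb C}$, $C^\infty(X,\mathbb C)$ and the complex bilinear extensions of the brackets in place of $\mathfrak g$, $\pi_x$, $C^\infty(X)$ and the brackets. 4. Let $\mathbb E^1,\mathbb E^2,\mathbb D\subset TX$ be locally homogeneous subbundles, $c_1,\dots,c_n\in\mathbb R$, and let $P_k:\mathbb E^1\to TX$, $Q_k:\mathbb E^2\to TX$ ($1\le k\le n$)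 be smooth vector bundle homomorphisms commuting with the differentials of the local transformations $g$ for $(g,y)$ near $\{e\}\times X$. Assume that the linear combination of brackets $(\xi,\eta)\mapsto\sum_k c_k[P_k\xi,Q_k\eta]$, as a map $\Gamma(X,\mathbb E^1)\times\Gamma(X,\mathbb E^2)\to\Gamma(X,TX)/\Gamma(X,\mathbb D)$, is $C^\infty(X)$-bilinear (the single brackets need not be). Then it is induced by a unique family of bilinear maps $b_y:\mathbb E^1_y\times\mathbb E^2_y\to T_yX/\mathbb D_y$, and for every linear section $\sigma:T_xX\to\mathfrak g$ of $\pi_x$ (i.e. for representatives taken in one fixed complement of $\mathfrak g_x$) and all $\nu^j\in\mathbb E^j_x$, $$b_x(\nu^1,\nu^2)=\sum_k c_k\,[\sigma(P_k\nu^1),\sigma(Q_k\nu^2)]_{\mathfrak g}\bmod\mathfrak d .$$ The same holds for complex subbundles of $T^{\mathbb C}X$, with complex $c_k$, complex linear $P_k,Q_k$ and complex linear sections $\sigma:T^{\mathbb C}_xX\to\mathfrak g^{\mathbb C}$ of $\pi^{\mathbb C}_x$. -/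

import Mathlib

open scoped Manifold ContDiff Topology TensorProduct
open VectorField

noncomputable section

/-- A smooth Lie group is regular enough for its Lie algebra to be defined. -/
instance leInfty_minSmoothness_three : ENat.LEInfty (minSmoothness ℝ 3) where
  out := by
    rw [minSmoothness_of_isRCLikeNormedField]
    exact ENat.LEInfty.out

/-! ### Tensors induced by operations on sections -/

section Tensors

variable {X : Type*} {K : Type*} [Field K] {V : X → Type*}
  [∀ y, AddCommGroup (V y)] [∀ y, Module K (V y)]

/-- The operation `Φ`, defined on pairs of sections in `S₁ × S₂` and with values in sections of `V`
modulo sections of `D`, is bilinear over the functions in `R`. -/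
structure IsBilinearMod (R : Set (X → K)) (S₁ S₂ : Set (∀ y, V y)) (D : ∀ y, Submodule K (V y))
    (Φ : (∀ y, V y) → (∀ y, V y) → ∀ y, V y) : Prop where
  add_left : ∀ ξ ∈ S₁, ∀ ξ' ∈ S₁, ∀ η ∈ S₂, ∀ y,
    Φ (fun z => ξ z + ξ' z) η y - (Φ ξ η y + Φ ξ' η y) ∈ D y
  add_right : ∀ ξ ∈ S₁, ∀ η ∈ S₂, ∀ η' ∈ S₂, ∀ y,
    Φ ξ (fun z => η z + η' z) y - (Φ ξ η y + Φ ξ η' y) ∈ D y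
  smul_left : ∀ f ∈ R, ∀ ξ ∈ S₁, ∀ η ∈ S₂, ∀ y,
    Φ (fun z => f z • ξ z) η y - f y • Φ ξ η y ∈ D y
  smul_right : ∀ f ∈ R, ∀ ξ ∈ S₁, ∀ η ∈ S₂, ∀ y,
    Φ ξ (fun z => f z • η z) y - f y • Φ ξ η y ∈ D y

/-- `b` is a tensor `E₁ ⊕ E₂ → V / D` (a family of bilinear maps on the fibres) inducing `Φ`:
`b (ξ y, η y) = Φ (ξ, η) y mod D y` for all sections `ξ ∈ S₁` of `E₁` and `η ∈ S₂` of `E₂`. -/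
def IsInducedTensor (S₁ S₂ : Set (∀ y, V y)) (E₁ E₂ D : ∀ y, Submodule K (V y))
    (Φ : (∀ y, V y) → (∀ y, V y) → ∀ y, V y)
    (b : ∀ y, E₁ y →ₗ[K] E₂ y →ₗ[K] (V y ⧸ D y)) : Prop :=
  ∀ ξ ∈ S₁, ∀ η ∈ S₂, ∀ (y : X) (h₁ : ξ y ∈ E₁ y) (h₂ : η y ∈ E₂ y),
    b y ⟨ξ y, h₁⟩ ⟨η y, h₂⟩ = (D y).mkQ (Φ ξ η y)

end Tensors

/-! ### Real and complex vector fields and subbundles -/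

section Fields

variable (EX : Type*) [NormedAddCommGroup EX] [NormedSpace ℝ EX]
  {X : Type*} [TopologicalSpace X] [ChartedSpace EX X] [IsManifold 𝓘(ℝ, EX) ∞ X]

/-- Smoothness on `U` of a real vector field. -/
def SmoothFieldOn (U : Set X) (ξ : ∀ y : X, TangentSpace 𝓘(ℝ, EX) y) : Prop :=
  ContMDiffOn 𝓘(ℝ, EX) 𝓘(ℝ, EX).tangent ∞
    (fun y => (⟨y, ξ y⟩ : TangentBundle 𝓘(ℝ, EX) X)) U

/-- `E` is a smooth subbundle of `TX`: locally, its fibres have a smooth frame. -/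
def IsSubbundle (E : ∀ y : X, Submodule ℝ (TangentSpace 𝓘(ℝ, EX) y)) : Prop :=
  ∀ y : X, ∃ U : Set X, IsOpen U ∧ y ∈ U ∧
    ∃ (r : ℕ) (s : Fin r → ∀ z : X, TangentSpace 𝓘(ℝ, EX) z),
      (∀ i, SmoothFieldOn EX U (s i)) ∧
      ∀ z ∈ U, LinearIndependent ℝ (fun i => s i z) ∧
        Submodule.span ℝ (Set.range fun i => s i z) = E z

/-- The set `Γ(X, E)` of global smooth sections of `E ⊆ TX`. -/
def smoothSections (E : ∀ y : X, Submodule ℝ (TangentSpace 𝓘(ℝ, EX) y)) :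
    Set (∀ y : X, TangentSpace 𝓘(ℝ, EX) y) :=
  {ξ | SmoothFieldOn EX Set.univ ξ ∧ ∀ y, ξ y ∈ E y}

/-- The smooth functions `X → F` (used for `F = ℝ` and `F = ℂ`). -/
def smoothFunctions (X : Type*) [TopologicalSpace X] [ChartedSpace EX X]
    (F : Type*) [NormedAddCommGroup F] [NormedSpace ℝ F] : Set (X → F) :=
  {f | ContMDiff 𝓘(ℝ, EX) 𝓘(ℝ, F) ∞ f}

/-- The fibre of the complexified tangent bundle at `y`. -/
abbrev CTangent (y : X) : Type _ := ℂ ⊗[ℝ] TangentSpace 𝓘(ℝ, EX) y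

/-- The real part `V ⊗ ℂ → V`. -/
def complexRe (V : Type*) [AddCommGroup V] [Module ℝ V] : ℂ ⊗[ℝ] V →ₗ[ℝ] V :=
  (TensorProduct.lid ℝ V).toLinearMap ∘ₗ LinearMap.rTensor V Complex.reLm

/-- The imaginary part `V ⊗ ℂ → V`. -/
def complexIm (V : Type*) [AddCommGroup V] [Module ℝ V] : ℂ ⊗[ℝ] V →ₗ[ℝ] V :=
  (TensorProduct.lid ℝ V).toLinearMap ∘ₗ LinearMap.rTensor V Complex.imLm

/-- The real part of a complex vector field. -/
def fieldRe (ζ : ∀ y : X, CTangent EX y) (y : X) : TangentSpace 𝓘(ℝ, EX) y :=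
  complexRe _ (ζ y)

/-- The imaginary part of a complex vector field. -/
def fieldIm (ζ : ∀ y : X, CTangent EX y) (y : X) : TangentSpace 𝓘(ℝ, EX) y :=
  complexIm _ (ζ y)

/-- Smoothness on `U` of a complex vector field. -/
def SmoothCFieldOn (U : Set X) (ζ : ∀ y : X, CTangent EX y) : Prop :=
  SmoothFieldOn EX U (fieldRe EX ζ) ∧ SmoothFieldOn EX U (fieldIm EX ζ)

/-- The complex bilinear extension of the Lie bracket to complex vector fields. -/
def cBracket (ζ ϑ : ∀ y : X, CTangent EX y) (y : X) : CTangent EX y :=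
  (1 : ℂ) ⊗ₜ[ℝ] (mlieBracket 𝓘(ℝ, EX) (fieldRe EX ζ) (fieldRe EX ϑ) y
      - mlieBracket 𝓘(ℝ, EX) (fieldIm EX ζ) (fieldIm EX ϑ) y)
    + Complex.I ⊗ₜ[ℝ] (mlieBracket 𝓘(ℝ, EX) (fieldRe EX ζ) (fieldIm EX ϑ) y
      + mlieBracket 𝓘(ℝ, EX) (fieldIm EX ζ) (fieldRe EX ϑ) y)

/-- `E` is a smooth complex subbundle of the complexified tangent bundle. -/
def IsCSubbundle (E : ∀ y : X, Submodule ℂ (CTangent EX y)) : Prop :=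
  ∀ y : X, ∃ U : Set X, IsOpen U ∧ y ∈ U ∧
    ∃ (r : ℕ) (s : Fin r → ∀ z : X, CTangent EX z),
      (∀ i, SmoothCFieldOn EX U (s i)) ∧
      ∀ z ∈ U, LinearIndependent ℂ (fun i => s i z) ∧
        Submodule.span ℂ (Set.range fun i => s i z) = E z

/-- The global smooth sections of a complex subbundle. -/
def smoothCSections (E : ∀ y : X, Submodule ℂ (CTangent EX y)) : Set (∀ y : X, CTangent EX y) :=
  {ζ | SmoothCFieldOn EX Set.univ ζ ∧ ∀ y, ζ y ∈ E y}

end Fields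

/-! ### Local actions of Lie groups -/

/-- A smooth local action of the Lie group `G` on the manifold `X`. The map `act` is only meaningful
on the open neighbourhood `domain` of `{1} × X`. -/
structure LocalAction (EG EX G X : Type*)
    [NormedAddCommGroup EG] [NormedSpace ℝ EG] [NormedAddCommGroup EX] [NormedSpace ℝ EX]
    [TopologicalSpace G] [ChartedSpace EG G] [Group G]
    [TopologicalSpace X] [ChartedSpace EX X] where
  domain : Set (G × X)
  act : G → X → X
  isOpen_domain : IsOpen domain
  one_mem : ∀ y, (1, y) ∈ domain
  smooth : ContMDiffOn (𝓘(ℝ, EG).prod 𝓘(ℝ, EX)) 𝓘(ℝ, EX) ∞ (fun p : G × X => act p.1 p.2) domain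
  one_act : ∀ y, act 1 y = y
  mul_act : ∀ h g y, (g, y) ∈ domain → (h, act g y) ∈ domain → (h * g, y) ∈ domain →
    act h (act g y) = act (h * g) y

namespace LocalAction

variable {EG EX G X : Type*}
  [NormedAddCommGroup EG] [NormedSpace ℝ EG] [NormedAddCommGroup EX] [NormedSpace ℝ EX]
  [TopologicalSpace G] [ChartedSpace EG G] [Group G]
  [TopologicalSpace X] [ChartedSpace EX X] [IsManifold 𝓘(ℝ, EX) ∞ X]
  (A : LocalAction EG EX G X)

/-- The differential at `y` of the local transformation `g`. -/
def diff (g : G) (y : X) :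
    TangentSpace 𝓘(ℝ, EX) y →ₗ[ℝ] TangentSpace 𝓘(ℝ, EX) (A.act g y) :=
  (mfderiv 𝓘(ℝ, EX) 𝓘(ℝ, EX) (A.act g) y).toLinearMap

/-- The differential at `1` of the orbit map `g ↦ g · y`, i.e. `v ↦ d/dt (exp (t v) · y)` at
`t = 0`. It is minus the evaluation at `y` of the fundamental vector field of `v`, when the latter
is defined through `exp (- t v)`. The target is the tangent space at `1 · y = y`. -/
def orbitDiff (y : X) : GroupLieAlgebra 𝓘(ℝ, EG) G →ₗ[ℝ] TangentSpace 𝓘(ℝ, EX) y :=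
  (mfderiv 𝓘(ℝ, EG) 𝓘(ℝ, EX) (fun g => A.act g y) (1 : G)).toLinearMap

/-- The local action is transitive, i.e. `X` is locally homogeneous. -/
def IsTransitive : Prop := ∀ y, Function.Surjective (A.orbitDiff y)

/-- The isotropy algebra at `x`. -/
def isotropy (x : X) : Submodule ℝ (GroupLieAlgebra 𝓘(ℝ, EG) G) := LinearMap.ker (A.orbitDiff x)

/-! #### Real subbundles -/

/-- `E` is a locally homogeneous subbundle of `TX`: a smooth subbundle preserved by the
differentials of the local transformations close to the identity. -/
def IsHomogeneousSubbundle (E : ∀ y : X, Submodule ℝ (TangentSpace 𝓘(ℝ, EX) y)) : Prop :=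
  IsSubbundle EX E ∧
    ∀ y : X, ∀ᶠ p : G × X in 𝓝 (1, y), (E p.2).map (A.diff p.1 p.2) = E (A.act p.1 p.2)

/-- `P` restricts to a smooth locally equivariant vector bundle homomorphism `E → TX`.
(The values of `P` outside `E` are irrelevant.) -/
def IsEquivariantHom (E : ∀ y : X, Submodule ℝ (TangentSpace 𝓘(ℝ, EX) y))
    (P : ∀ y : X, TangentSpace 𝓘(ℝ, EX) y →ₗ[ℝ] TangentSpace 𝓘(ℝ, EX) y) : Prop :=
  (∀ ξ ∈ smoothSections EX E, SmoothFieldOn EX Set.univ (fun y => P y (ξ y))) ∧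
    ∀ y : X, ∀ᶠ p : G × X in 𝓝 (1, y), ∀ v ∈ E p.2,
      P (A.act p.1 p.2) (A.diff p.1 p.2 v) = A.diff p.1 p.2 (P p.2 v)

/-- The subspace `𝔢 ⊆ 𝔤` corresponding to `E`: it contains the isotropy algebra `𝔤ₓ` and
`Eₓ = 𝔢 / 𝔤ₓ` under the identification `TₓX = 𝔤 / 𝔤ₓ`. -/
def modelSubspace (E : ∀ y : X, Submodule ℝ (TangentSpace 𝓘(ℝ, EX) y)) (x : X) :
    Submodule ℝ (GroupLieAlgebra 𝓘(ℝ, EG) G) :=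
  (E x).comap (A.orbitDiff x)

/-- The canonical map `𝔤 / 𝔡 → TₓX / Dₓ`. -/
def modelQuot (D : ∀ y : X, Submodule ℝ (TangentSpace 𝓘(ℝ, EX) y)) (x : X) :
    (GroupLieAlgebra 𝓘(ℝ, EG) G ⧸ A.modelSubspace D x) →ₗ[ℝ]
      (TangentSpace 𝓘(ℝ, EX) x ⧸ D x) :=
  (A.modelSubspace D x).mapQ (D x) (A.orbitDiff x)
    (show A.modelSubspace D x ≤ (D x).comap (A.orbitDiff x) from le_rfl)

set_option linter.unusedSectionVars false in
/-- For transitive actions the canonical map identifies `𝔤 / 𝔡` with `TₓX / Dₓ`. -/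
theorem modelQuot_bijective (hA : A.IsTransitive)
    (D : ∀ y : X, Submodule ℝ (TangentSpace 𝓘(ℝ, EX) y)) (x : X) :
    Function.Bijective (A.modelQuot D x) := by
  constructor
  · rw [← LinearMap.ker_eq_bot, modelQuot, Submodule.ker_mapQ]
    exact Submodule.mkQ_map_self _
  · intro q
    obtain ⟨v, rfl⟩ := Submodule.mkQ_surjective _ q
    obtain ⟨u, rfl⟩ := hA x v
    exact ⟨Submodule.mkQ _ u, rfl⟩

/-! #### Complex subbundles of the complexified tangent bundle -/

/-- The complexified differential of the local transformation `g`. -/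
def cDiff (g : G) (y : X) : CTangent EX y →ₗ[ℂ] CTangent EX (A.act g y) :=
  (A.diff g y).baseChange ℂ

/-- The complexified differential of the orbit map. -/
def cOrbitDiff (y : X) : (ℂ ⊗[ℝ] GroupLieAlgebra 𝓘(ℝ, EG) G) →ₗ[ℂ] CTangent EX y :=
  (A.orbitDiff y).baseChange ℂ

/-- The complexified isotropy algebra at `x`. -/
def cIsotropy (x : X) : Submodule ℂ (ℂ ⊗[ℝ] GroupLieAlgebra 𝓘(ℝ, EG) G) :=
  (A.isotropy x).baseChange ℂ

/-- `E` is a locally homogeneous complex subbundle of the complexified tangent bundle. -/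
def IsHomogeneousCSubbundle (E : ∀ y : X, Submodule ℂ (CTangent EX y)) : Prop :=
  IsCSubbundle EX E ∧
    ∀ y : X, ∀ᶠ p : G × X in 𝓝 (1, y), (E p.2).map (A.cDiff p.1 p.2) = E (A.act p.1 p.2)

/-- `P` restricts to a smooth locally equivariant homomorphism of complex vector bundles from `E`
to the complexified tangent bundle. (The values of `P` outside `E` are irrelevant.) -/
def IsEquivariantCHom (E : ∀ y : X, Submodule ℂ (CTangent EX y))
    (P : ∀ y : X, CTangent EX y →ₗ[ℂ] CTangent EX y) : Prop :=
  (∀ ζ ∈ smoothCSections EX E, SmoothCFieldOn EX Set.univ (fun y => P y (ζ y))) ∧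
    ∀ y : X, ∀ᶠ p : G × X in 𝓝 (1, y), ∀ v ∈ E p.2,
      P (A.act p.1 p.2) (A.cDiff p.1 p.2 v) = A.cDiff p.1 p.2 (P p.2 v)

/-- The complex subspace of the complexified Lie algebra corresponding to `E`. -/
def cModelSubspace (E : ∀ y : X, Submodule ℂ (CTangent EX y)) (x : X) :
    Submodule ℂ (ℂ ⊗[ℝ] GroupLieAlgebra 𝓘(ℝ, EG) G) :=
  (E x).comap (A.cOrbitDiff x)

/-- The canonical map from the complexified Lie algebra modulo `𝔡` to the complexified tangent
space modulo `Dₓ`. -/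
def cModelQuot (D : ∀ y : X, Submodule ℂ (CTangent EX y)) (x : X) :
    ((ℂ ⊗[ℝ] GroupLieAlgebra 𝓘(ℝ, EG) G) ⧸ A.cModelSubspace D x) →ₗ[ℂ] (CTangent EX x ⧸ D x) :=
  (A.cModelSubspace D x).mapQ (D x) (A.cOrbitDiff x)
    (show A.cModelSubspace D x ≤ (D x).comap (A.cOrbitDiff x) from le_rfl)

set_option linter.unusedSectionVars false in
/-- For transitive actions the canonical map is bijective in the complexified situation, too. -/
theorem cModelQuot_bijective (hA : A.IsTransitive)
    (D : ∀ y : X, Submodule ℂ (CTangent EX y)) (x : X) :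
    Function.Bijective (A.cModelQuot D x) := by
  constructor
  · rw [← LinearMap.ker_eq_bot, cModelQuot, Submodule.ker_mapQ]
    exact Submodule.mkQ_map_self _
  · intro q
    obtain ⟨v, rfl⟩ := Submodule.mkQ_surjective _ q
    have hs : Function.Surjective (A.cOrbitDiff x) :=
      LinearMap.lTensor_surjective ℂ (hA x)
    obtain ⟨u, rfl⟩ := hs v
    exact ⟨Submodule.mkQ _ u, rfl⟩

end LocalAction

end

/-! ### Tensors from bilinear operations on sections -/

section LocalFrames

variable {X : Type*} {K : Type*} [Field K] {V : X → Type*}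
  [∀ y, AddCommGroup (V y)] [∀ y, Module K (V y)]

/-! For `u ∈ 𝔤` let `u*` be the fundamental field `y ↦ π_y(u)`. The orbit maps carry right-invariant
fields to fundamental ones, so `[u*, v*] = -[u, v]*`. If `u, v` represent the values at `x` of two
fields `ξ, η`, then `ξ - u*` and `η - v*` vanish at `x`, and so does their bracket. Expanding it
gives `[ξ, η]_x = π_x [u, v] + [u*, η]_x - [v*, ξ]_x`.

Homogeneity controls the two corrections: `[u*, η]_x` is the derivative, at the identity and in the
direction `u`, of the vector at `x` obtained by transporting `η(g·x)` back by `dg`. If `η` is a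
section of a homogeneous `E`, these vectors stay in `E_x`, hence so does the derivative; for the
same reason the correction commutes with equivariant homomorphisms. The case `ξ = 0` already gives
the stability under the isotropy algebra.

Replacing `η` by `f η` with `df_x = α` adds `α(ν¹) ν²` to the correction, so bilinearity over
functions forces `α(ν¹) ν² ∈ D_x` for all `α`. For a single bracket with `E¹_x ≠ 0` this says `E²_x
⊆ D_x`, and symmetrically, so both corrections vanish modulo `D_x`. For a combination it says only
`∑ c_k α(P_k ν¹) Q_k ν² ∈ D_x`. The correction is then `∑ c_k Q_k T(P_k ν¹)` with `T v = [σ(v)*,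
η]_x`. As `σ` is linear, `T` is a linear map into `E²_x`, hence a sum of rank one maps, and the
correction lies in `D_x`.

The algebra is carried out once over a field `K`, from the axioms `HasLocalFrames` and
`IsBracketModel`. The geometry enters through `lieBracket_fundamentalField` and
`hasFDerivAt_transport`, both consequences of the symmetry of second derivatives; the complex case
is reduced to real and imaginary parts. -/

/-- `S` is a module of sections of `E` over the functions in `R`, generated near each point by
finitely many sections which form a basis of the fibre of `E`. -/
structure HasLocalFrames (R : Set (X → K)) (S : Set (∀ y, V y)) (E : ∀ y, Submodule K (V y)) :
    Prop where
  const_mem : ∀ c : K, (fun _ => c) ∈ R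
  mem : ∀ ξ ∈ S, ∀ y, ξ y ∈ E y
  zero : (fun _ => 0) ∈ S
  add : ∀ ξ ∈ S, ∀ η ∈ S, (fun z => ξ z + η z) ∈ S
  smul : ∀ f ∈ R, ∀ ξ ∈ S, (fun z => f z • ξ z) ∈ S
  frame : ∀ y, ∃ (r : ℕ) (s : Fin r → ∀ z, V z), (∀ i, s i ∈ S) ∧
    LinearIndependent K (fun i => s i y) ∧ Submodule.span K (Set.range fun i => s i y) = E y ∧
    -- A global section is a combination of the global sections `s i` only after multiplication by a
    -- cutoff `χ`. Operations linear over functions do not notice this at `y`, because `χ y = 1`.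
    ∀ ξ ∈ S, ∃ χ ∈ R, ∃ f : Fin r → X → K, (∀ i, f i ∈ R) ∧ χ y = 1 ∧
      ∀ z, χ z • ξ z = ∑ i, f i z • s i z

namespace HasLocalFrames

variable {R : Set (X → K)} {S S₁ S₂ : Set (∀ y, V y)} {E E₁ E₂ D : ∀ y, Submodule K (V y)}
  {A : Type*} [AddCommGroup A] [Module K A]

theorem sum_mem (hS : HasLocalFrames R S E) {ι : Type*} (t : Finset ι) (s : ι → ∀ z, V z)
    (hs : ∀ i ∈ t, s i ∈ S) : (fun z => ∑ i ∈ t, s i z) ∈ S := by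
  classical
  induction t using Finset.induction_on with
  | empty => simpa using hS.zero
  | insert a t ha ih =>
    simp only [Finset.sum_insert ha]
    exact hS.add _ (hs a (Finset.mem_insert_self a t)) _
      (ih fun i hi => hs i (Finset.mem_insert_of_mem hi))

theorem exists_section (hS : HasLocalFrames R S E) {y : X} {v : V y} (hv : v ∈ E y) :
    ∃ ξ ∈ S, ξ y = v := by
  obtain ⟨r, s, hs, -, hspan, -⟩ := hS.frame y
  rw [← hspan] at hv
  obtain ⟨c, rfl⟩ := (Submodule.mem_span_range_iff_exists_fun K).1 hv
  exact ⟨fun z => ∑ i, c i • s i z,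
    hS.sum_mem _ _ fun i _ => hS.smul _ (hS.const_mem (c i)) _ (hs i), rfl⟩

/-- An operation on sections which is linear over functions only depends on the value of the
section. -/
theorem eq_of_apply_eq (hS : HasLocalFrames R S E) {y : X} {ψ : (∀ y, V y) → A}
    (hadd : ∀ ξ ∈ S, ∀ η ∈ S, ψ (fun z => ξ z + η z) = ψ ξ + ψ η)
    (hsmul : ∀ f ∈ R, ∀ ξ ∈ S, ψ (fun z => f z • ξ z) = f y • ψ ξ)
    {ξ η : ∀ y, V y} (hξ : ξ ∈ S) (hη : η ∈ S) (h : ξ y = η y) : ψ ξ = ψ η := by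
  classical
  obtain ⟨r, s, hs, hli, -, hex⟩ := hS.frame y
  have hzero : ψ (fun _ => 0) = 0 := by
    have := hadd _ hS.zero _ hS.zero
    simpa using this
  have hsum : ∀ (t : Finset (Fin r)) (f : Fin r → X → K), (∀ i, f i ∈ R) →
      ψ (fun z => ∑ i ∈ t, f i z • s i z) = ∑ i ∈ t, f i y • ψ (s i) := by
    intro t f hf
    induction t using Finset.induction_on with
    | empty => simpa using hzero
    | insert a t ha ih =>
      simp only [Finset.sum_insert ha]
      rw [hadd _ (hS.smul _ (hf a) _ (hs a)) _
        (hS.sum_mem _ _ fun i _ => hS.smul _ (hf i) _ (hs i)), ih, hsmul _ (hf a) _ (hs a)]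
  -- Since `χ y = 1`, `ψ ζ = ψ (χ ζ) = ∑ f i y • ψ (s i)`. The numbers `f i y` are the coordinates
  -- of `ζ y` in a basis of the fibre, so they depend on `ζ y` only.
  have key : ∀ ζ ∈ S, ∃ c : Fin r → K, ζ y = ∑ i, c i • s i y ∧ ψ ζ = ∑ i, c i • ψ (s i) := by
    intro ζ hζ
    obtain ⟨χ, hχ, f, hf, hχy, he⟩ := hex ζ hζ
    refine ⟨fun i => f i y, by simpa [hχy] using he y, ?_⟩
    have h1 := hsmul χ hχ ζ hζ
    rw [funext he, hsum _ f hf, hχy, one_smul] at h1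
    exact h1.symm
  obtain ⟨c, hc, hc'⟩ := key ξ hξ
  obtain ⟨d, hd, hd'⟩ := key η hη
  have hcd : c = d := by
    rw [hc, hd] at h
    funext i
    exact sub_eq_zero.1 (Fintype.linearIndependent_iff.1 hli (c - d)
      (by simp only [Pi.sub_apply, sub_smul, Finset.sum_sub_distrib, h, sub_self]) i)
  rw [hc', hd', hcd]

/-- An operation on sections which is linear over functions is induced by a linear map on the
fibre. -/
theorem exists_linearMap (hS : HasLocalFrames R S E) (y : X) (ψ : (∀ y, V y) → A)
    (hadd : ∀ ξ ∈ S, ∀ η ∈ S, ψ (fun z => ξ z + η z) = ψ ξ + ψ η)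
    (hsmul : ∀ f ∈ R, ∀ ξ ∈ S, ψ (fun z => f z • ξ z) = f y • ψ ξ) :
    ∃ L : E y →ₗ[K] A, ∀ ξ ∈ S, ∀ h : ξ y ∈ E y, L ⟨ξ y, h⟩ = ψ ξ := by
  choose ext hext hval using fun v : E y => hS.exists_section v.2
  refine ⟨⟨⟨fun v => ψ (ext v), fun v w => ?_⟩, fun c v => ?_⟩, fun ξ hξ h => ?_⟩
  · rw [← hadd _ (hext v) _ (hext w)]
    exact hS.eq_of_apply_eq hadd hsmul (hext _) (hS.add _ (hext v) _ (hext w)) (by simp [hval])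
  · rw [RingHom.id_apply, ← hsmul _ (hS.const_mem c) _ (hext v)]
    exact hS.eq_of_apply_eq hadd hsmul (hext _) (hS.smul _ (hS.const_mem c) _ (hext v))
      (by simp [hval])
  · exact hS.eq_of_apply_eq hadd hsmul (hext _) hξ (hval _)

/-- An operation which is bilinear over functions, modulo sections of `D`, is induced by a unique
tensor. -/
theorem exists_inducedTensor (h₁ : HasLocalFrames R S₁ E₁) (h₂ : HasLocalFrames R S₂ E₂)
    {Φ : (∀ y, V y) → (∀ y, V y) → ∀ y, V y} (hΦ : IsBilinearMod R S₁ S₂ D Φ) :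
    ∃ b : ∀ y, E₁ y →ₗ[K] E₂ y →ₗ[K] (V y ⧸ D y),
      ∀ b', IsInducedTensor S₁ S₂ E₁ E₂ D Φ b' ↔ b' = b := by
  have hmk : ∀ y (v w : V y), v - w ∈ D y → (D y).mkQ v = (D y).mkQ w := fun y v w h =>
    (Submodule.Quotient.eq _).2 h
  have hL : ∀ y, ∀ η ∈ S₂, ∃ L : E₁ y →ₗ[K] (V y ⧸ D y), ∀ ξ ∈ S₁, ∀ h : ξ y ∈ E₁ y,
      L ⟨ξ y, h⟩ = (D y).mkQ (Φ ξ η y) := fun y η hη =>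
    h₁.exists_linearMap y (fun ξ => (D y).mkQ (Φ ξ η y))
      (fun ξ hξ ξ' hξ' => by
        rw [← map_add]; exact hmk _ _ _ (hΦ.add_left ξ hξ ξ' hξ' η hη y))
      (fun f hf ξ hξ => by
        rw [← map_smul]; exact hmk _ _ _ (hΦ.smul_left f hf ξ hξ η hη y))
  choose! L hL using hL
  have hext : ∀ y (M N : E₁ y →ₗ[K] (V y ⧸ D y)),
      (∀ ξ ∈ S₁, ∀ h : ξ y ∈ E₁ y, M ⟨ξ y, h⟩ = N ⟨ξ y, h⟩) → M = N := by
    intro y M N h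
    ext ⟨v, hv⟩
    obtain ⟨ξ, hξ, rfl⟩ := h₁.exists_section hv
    exact h ξ hξ hv
  -- The linear-map lemma is applied a second time, to `η ↦ L y η` with values in a space of linear
  -- maps. The arguments therefore come out in reverse order, and the tensor is the flip of `B`.
  have hB : ∀ y, ∃ B : E₂ y →ₗ[K] E₁ y →ₗ[K] (V y ⧸ D y), ∀ η ∈ S₂, ∀ h : η y ∈ E₂ y,
      B ⟨η y, h⟩ = L y η := fun y =>
    h₂.exists_linearMap y (L y)
      (fun η hη η' hη' => hext y _ _ fun ξ hξ h => by
        rw [LinearMap.add_apply, hL y _ (h₂.add _ hη _ hη') ξ hξ, hL y _ hη ξ hξ,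
          hL y _ hη' ξ hξ, ← map_add]
        exact hmk _ _ _ (hΦ.add_right ξ hξ η hη η' hη' y))
      (fun f hf η hη => hext y _ _ fun ξ hξ h => by
        rw [LinearMap.smul_apply, hL y _ (h₂.smul _ hf _ hη) ξ hξ, hL y _ hη ξ hξ, ← map_smul]
        exact hmk _ _ _ (hΦ.smul_right f hf ξ hξ η hη y))
  choose B hB using hB
  have hind : IsInducedTensor S₁ S₂ E₁ E₂ D Φ fun y => (B y).flip := by
    intro ξ hξ η hη y hξy hηy
    rw [LinearMap.flip_apply, hB y η hη, hL y η hη ξ hξ]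
  refine ⟨fun y => (B y).flip, fun b' => ⟨fun h => ?_, fun h => h ▸ hind⟩⟩
  funext y
  ext ⟨v, hv⟩ ⟨w, hw⟩
  obtain ⟨ξ, hξ, rfl⟩ := h₁.exists_section hv
  obtain ⟨η, hη, rfl⟩ := h₂.exists_section hw
  rw [h ξ hξ η hη, hind ξ hξ η hη]

end HasLocalFrames

end LocalFrames

/-! ### Brackets of sections and an algebraic model at a point -/

section BracketModel

variable {X : Type*} {K : Type*} [Field K] {V : X → Type*}
  [∀ y, AddCommGroup (V y)] [∀ y, Module K (V y)]
  {𝔤 : Type*} [LieRing 𝔤] [LieAlgebra K 𝔤]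

/-- The bracket `B` on the sections in `S` is described at `x` by the Lie algebra `𝔤`, the
projection `π : 𝔤 → V x` and the infinitesimal action `Λ` of `𝔤` on sections. -/
structure IsBracketModel (x : X) (R : Set (X → K)) (S : Set (∀ y, V y))
    (B : (∀ y, V y) → (∀ y, V y) → ∀ y, V y) (π : 𝔤 →ₗ[K] V x)
    (Λ : (∀ y, V y) → 𝔤 →ₗ[K] V x) : Prop where
  surjective : Function.Surjective π
  zero_mem : (fun _ => 0) ∈ S
  zero_bracket : ∀ η, B (fun _ => 0) η x = 0
  zero_act : Λ (fun _ => 0) = 0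
  -- `Λ η u` stands for `[u*, η]_x`.
  bracket_eq : ∀ ξ ∈ S, ∀ η ∈ S, ∀ u v, π u = ξ x → π v = η x →
    B ξ η x = π ⁅u, v⁆ + Λ η u - Λ ξ v
  -- Here `f` is a function with differential `α` at `x`; one `f` serves all sections.
  leibniz : ∀ α : V x →ₗ[K] K, ∃ f ∈ R, ∀ η ∈ S, (fun z => f z • η z) ∈ S ∧
    ∀ u, Λ (fun z => f z • η z) u = f x • Λ η u + α (π u) • η x

namespace IsBracketModel

variable {x : X} {R : Set (X → K)} {S S' S₁ S₂ : Set (∀ y, V y)}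
  {E E₁ E₂ D : ∀ y, Submodule K (V y)}
  {B : (∀ y, V y) → (∀ y, V y) → ∀ y, V y} {π : 𝔤 →ₗ[K] V x} {Λ : (∀ y, V y) → 𝔤 →ₗ[K] V x}

/-- For a section `η` through `π u`, the bracket formula for the pair `(0, η)` with representatives
`h, u` reads `0 = π ⁅h, u⁆ + Λ η h`. -/
theorem lie_mem (hB : IsBracketModel x R S B π Λ) (hS' : HasLocalFrames R S' E) (hSS : S' ⊆ S)
    (hΛ : ∀ ξ ∈ S', ∀ u, Λ ξ u ∈ E x) {h u : 𝔤} (hh : π h = 0) (hu : π u ∈ E x) :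
    π ⁅h, u⁆ ∈ E x := by
  obtain ⟨η, hη, hηx⟩ := hS'.exists_section hu
  have := hB.bracket_eq _ hB.zero_mem η (hSS hη) h u hh hηx.symm
  rw [hB.zero_bracket, hB.zero_act, LinearMap.zero_apply, sub_zero] at this
  rw [eq_neg_of_add_eq_zero_left this.symm]
  exact neg_mem (hΛ η hη h)

/-! ### Linear combinations of brackets. -/

section Combination

variable {n : ℕ} {c : Fin n → K} {P Q : Fin n → ∀ y, V y →ₗ[K] V y}
  {Φ : (∀ y, V y) → (∀ y, V y) → ∀ y, V y}

/-- The defect of linearity in `η`: with `f` of differential `α` at `x`, the terms `π ⁅u, v⁆` and `Λ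
ξ v` scale with `f x`, and only the Leibniz term of `Λ (f η) u` survives in `Φ (ξ, f η) - f Φ (ξ,
η)`. Bilinearity modulo `D` puts it into `D x`. -/
theorem combination_smul_right (hB : IsBracketModel x R S B π Λ) (h₁ : HasLocalFrames R S₁ E₁)
    (h₂ : HasLocalFrames R S₂ E₂)
    (hP : ∀ k, ∀ ξ ∈ S₁, (fun z => P k z (ξ z)) ∈ S)
    (hQ : ∀ k, ∀ ξ ∈ S₂, (fun z => Q k z (ξ z)) ∈ S)
    (hΦ : ∀ ξ η, Φ ξ η x = ∑ k, c k • B (fun z => P k z (ξ z)) (fun z => Q k z (η z)) x)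
    (hbil : IsBilinearMod R S₁ S₂ D Φ) (α : V x →ₗ[K] K)
    {ν₁ ν₂ : V x} (hν₁ : ν₁ ∈ E₁ x) (hν₂ : ν₂ ∈ E₂ x) :
    ∑ k, (c k * α (P k x ν₁)) • Q k x ν₂ ∈ D x := by
  obtain ⟨f, hf, hleib⟩ := hB.leibniz α
  obtain ⟨ξ, hξ, rfl⟩ := h₁.exists_section hν₁
  obtain ⟨η, hη, rfl⟩ := h₂.exists_section hν₂
  have hmem := hbil.smul_right f hf ξ hξ η hη x
  convert hmem using 1
  rw [hΦ, hΦ, Finset.smul_sum, ← Finset.sum_sub_distrib]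
  refine Finset.sum_congr rfl fun k _ => ?_
  obtain ⟨u, hu⟩ := hB.surjective (P k x (ξ x))
  obtain ⟨v, hv⟩ := hB.surjective (Q k x (η x))
  obtain ⟨hfη, hl⟩ := hleib _ (hQ k η hη)
  simp only [map_smul]
  rw [hB.bracket_eq _ (hP k ξ hξ) _ hfη u (f x • v) hu (by simp [hv]),
    hB.bracket_eq _ (hP k ξ hξ) _ (hQ k η hη) u v hu hv, hl, hu, lie_smul, map_smul, map_smul]
  module

/-- The mirror image of `combination_smul_right`. The Leibniz term now comes from `- Λ ξ v`, whence
the passage to the negative. -/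
theorem combination_smul_left (hB : IsBracketModel x R S B π Λ) (h₁ : HasLocalFrames R S₁ E₁)
    (h₂ : HasLocalFrames R S₂ E₂)
    (hP : ∀ k, ∀ ξ ∈ S₁, (fun z => P k z (ξ z)) ∈ S)
    (hQ : ∀ k, ∀ ξ ∈ S₂, (fun z => Q k z (ξ z)) ∈ S)
    (hΦ : ∀ ξ η, Φ ξ η x = ∑ k, c k • B (fun z => P k z (ξ z)) (fun z => Q k z (η z)) x)
    (hbil : IsBilinearMod R S₁ S₂ D Φ) (α : V x →ₗ[K] K)
    {ν₁ ν₂ : V x} (hν₁ : ν₁ ∈ E₁ x) (hν₂ : ν₂ ∈ E₂ x) :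
    ∑ k, (c k * α (Q k x ν₂)) • P k x ν₁ ∈ D x := by
  obtain ⟨f, hf, hleib⟩ := hB.leibniz α
  obtain ⟨ξ, hξ, rfl⟩ := h₁.exists_section hν₁
  obtain ⟨η, hη, rfl⟩ := h₂.exists_section hν₂
  have hmem := neg_mem (hbil.smul_left f hf ξ hξ η hη x)
  convert hmem using 1
  rw [hΦ, hΦ, Finset.smul_sum, ← Finset.sum_sub_distrib, ← Finset.sum_neg_distrib]
  refine Finset.sum_congr rfl fun k _ => ?_
  obtain ⟨u, hu⟩ := hB.surjective (P k x (ξ x))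
  obtain ⟨v, hv⟩ := hB.surjective (Q k x (η x))
  obtain ⟨hfξ, hl⟩ := hleib _ (hP k ξ hξ)
  simp only [map_smul]
  rw [hB.bracket_eq _ hfξ _ (hQ k η hη) (f x • u) v (by simp [hu]) hv,
    hB.bracket_eq _ (hP k ξ hξ) _ (hQ k η hη) u v hu hv, hl, hv, smul_lie, map_smul, map_smul]
  module

/-- The tensor induced by a linear combination of brackets, computed with representatives in a
fixed complement of the kernel of `π`. -/
theorem combination_eq [∀ y, FiniteDimensional K (V y)] (hB : IsBracketModel x R S B π Λ)
    (h₁ : HasLocalFrames R S₁ E₁) (h₂ : HasLocalFrames R S₂ E₂)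
    (hΛ₁ : ∀ ξ ∈ S₁, ∀ u, Λ ξ u ∈ E₁ x) (hΛ₂ : ∀ ξ ∈ S₂, ∀ u, Λ ξ u ∈ E₂ x)
    (hP : ∀ k, ∀ ξ ∈ S₁, (fun z => P k z (ξ z)) ∈ S)
    (hQ : ∀ k, ∀ ξ ∈ S₂, (fun z => Q k z (ξ z)) ∈ S)
    (hΛP : ∀ k, ∀ ξ ∈ S₁, ∀ u, Λ (fun z => P k z (ξ z)) u = P k x (Λ ξ u))
    (hΛQ : ∀ k, ∀ ξ ∈ S₂, ∀ u, Λ (fun z => Q k z (ξ z)) u = Q k x (Λ ξ u))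
    (hΦ : ∀ ξ η, Φ ξ η x = ∑ k, c k • B (fun z => P k z (ξ z)) (fun z => Q k z (η z)) x)
    (hbil : IsBilinearMod R S₁ S₂ D Φ)
    {b : ∀ y, E₁ y →ₗ[K] E₂ y →ₗ[K] (V y ⧸ D y)} (hb : IsInducedTensor S₁ S₂ E₁ E₂ D Φ b)
    {σ : V x →ₗ[K] 𝔤} (hσ : ∀ v, π (σ v) = v) (ν₁ : E₁ x) (ν₂ : E₂ x) :
    b x ν₁ ν₂ = (D x).mkQ (π (∑ k, c k • ⁅σ (P k x ν₁), σ (Q k x ν₂)⁆)) := by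
  obtain ⟨ν₁, hν₁⟩ := ν₁
  obtain ⟨ν₂, hν₂⟩ := ν₂
  obtain ⟨ξ, hξ, rfl⟩ := h₁.exists_section hν₁
  obtain ⟨η, hη, rfl⟩ := h₂.exists_section hν₂
  rw [hb ξ hξ η hη]
  refine (Submodule.Quotient.eq _).2 ?_
  -- a linear map into a fibre of `E` is a sum of rank one maps
  have rank_one : ∀ (F : Submodule K (V x)) (T : V x →ₗ[K] V x), (∀ v, T v ∈ F) →
      ∃ (m : ℕ) (α : Fin m → V x →ₗ[K] K) (e : Fin m → V x), (∀ j, e j ∈ F) ∧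
        ∀ v, T v = ∑ j, α j v • e j := by
    intro F T hT
    let e := Module.finBasis K F
    refine ⟨_, fun j => e.coord j ∘ₗ T.codRestrict F hT, fun j => e j, fun j => (e j).2,
      fun v => ?_⟩
    have := congrArg (Subtype.val) (e.sum_repr (T.codRestrict F hT v))
    simpa [-Module.Basis.sum_repr] using this.symm
  obtain ⟨m, α, e, he, hαe⟩ := rank_one (E₂ x) (Λ η ∘ₗ σ) fun v => hΛ₂ η hη _
  obtain ⟨m', α', e', he', hαe'⟩ := rank_one (E₁ x) (Λ ξ ∘ₗ σ) fun v => hΛ₁ ξ hξ _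
  -- This is the correction `∑ c_k Q_k T (P_k ν₁)` with `T = Λ η ∘ σ = ∑ α_j ⊗ e_j`. After
  -- exchanging the sums, each `j` contributes a defect of linearity for the covector `α_j` and the
  -- vectors `ν₁` and `e_j ∈ E₂ x`.
  have hright : ∑ k, c k • Q k x (Λ η (σ (P k x (ξ x)))) ∈ D x := by
    have : ∑ k, c k • Q k x (Λ η (σ (P k x (ξ x)))) =
        ∑ j, ∑ k, (c k * α j (P k x (ξ x))) • Q k x (e j) := by
      rw [Finset.sum_comm]
      refine Finset.sum_congr rfl fun k _ => ?_
      have := hαe (P k x (ξ x))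
      rw [LinearMap.comp_apply] at this
      simp [this, Finset.smul_sum, mul_smul]
    rw [this]
    exact sum_mem fun j _ => hB.combination_smul_right h₁ h₂ hP hQ hΦ hbil (α j) hν₁ (he j)
  have hleft : ∑ k, c k • P k x (Λ ξ (σ (Q k x (η x)))) ∈ D x := by
    have : ∑ k, c k • P k x (Λ ξ (σ (Q k x (η x)))) =
        ∑ j, ∑ k, (c k * α' j (Q k x (η x))) • P k x (e' j) := by
      rw [Finset.sum_comm]
      refine Finset.sum_congr rfl fun k _ => ?_
      have := hαe' (Q k x (η x))
      rw [LinearMap.comp_apply] at this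
      simp [this, Finset.smul_sum, mul_smul]
    rw [this]
    exact sum_mem fun j _ => hB.combination_smul_left h₁ h₂ hP hQ hΦ hbil (α' j) (he' j) hν₂
  convert sub_mem hright hleft using 1
  rw [hΦ, map_sum, ← Finset.sum_sub_distrib, ← Finset.sum_sub_distrib]
  refine Finset.sum_congr rfl fun k _ => ?_
  rw [hB.bracket_eq _ (hP k ξ hξ) _ (hQ k η hη) _ _ (hσ _) (hσ _), hΛP k ξ hξ, hΛQ k η hη,
    map_smul]
  module

end Combination

/-- The tensor induced by the bracket, computed with arbitrary representatives. -/
theorem bracket_tensor_eq [∀ y, FiniteDimensional K (V y)] (hB : IsBracketModel x R S B π Λ)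
    (h₁ : HasLocalFrames R S₁ E₁) (h₂ : HasLocalFrames R S₂ E₂) (hS₁ : S₁ ⊆ S) (hS₂ : S₂ ⊆ S)
    (hΛ₁ : ∀ ξ ∈ S₁, ∀ u, Λ ξ u ∈ E₁ x) (hΛ₂ : ∀ ξ ∈ S₂, ∀ u, Λ ξ u ∈ E₂ x)
    (hbil : IsBilinearMod R S₁ S₂ D B)
    {b : ∀ y, E₁ y →ₗ[K] E₂ y →ₗ[K] (V y ⧸ D y)} (hb : IsInducedTensor S₁ S₂ E₁ E₂ D B b)
    (h₁₂ : E₁ x = ⊥ → E₂ x ≤ D x) (h₂₁ : E₂ x = ⊥ → E₁ x ≤ D x)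
    (ν₁ : E₁ x) (ν₂ : E₂ x) {u₁ u₂ : 𝔤} (hu₁ : π u₁ = ν₁) (hu₂ : π u₂ = ν₂) :
    b x ν₁ ν₂ = (D x).mkQ (π ⁅u₁, u₂⁆) := by
  -- The bracket is treated as a combination with one summand, coefficient `1` and identity
  -- homomorphisms.
  have hP : ∀ _k : Fin 1, ∀ ξ ∈ S₁, (fun z => (LinearMap.id : V z →ₗ[K] V z) (ξ z)) ∈ S :=
    fun _ ξ hξ => hS₁ hξ
  have hQ : ∀ _k : Fin 1, ∀ ξ ∈ S₂, (fun z => (LinearMap.id : V z →ₗ[K] V z) (ξ z)) ∈ S :=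
    fun _ ξ hξ => hS₂ hξ
  have hΦ : ∀ ξ η, B ξ η x = ∑ _k : Fin 1, (1 : K) •
      B (fun z => (LinearMap.id : V z →ₗ[K] V z) (ξ z))
        (fun z => (LinearMap.id : V z →ₗ[K] V z) (η z)) x := by simp
  have dual : ∀ v : V x, v ≠ 0 → ∃ α : V x →ₗ[K] K, α v = 1 := fun v hv =>
    Module.Projective.exists_dual_eq_one K hv
  -- If some `ν ∈ E₁ x` is non-zero, a covector with `α ν = 1` turns the defect `α(ν) w` into `w`
  -- itself.
  have hE₂ : E₂ x ≤ D x := by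
    by_cases h : E₁ x = ⊥
    · exact h₁₂ h
    obtain ⟨ν, hν, hν0⟩ := Submodule.exists_mem_ne_zero_of_ne_bot h
    obtain ⟨α, hα⟩ := dual ν hν0
    intro w hw
    simpa [hα] using hB.combination_smul_right h₁ h₂ hP hQ hΦ hbil α hν hw
  have hE₁ : E₁ x ≤ D x := by
    by_cases h : E₂ x = ⊥
    · exact h₂₁ h
    obtain ⟨ν, hν, hν0⟩ := Submodule.exists_mem_ne_zero_of_ne_bot h
    obtain ⟨α, hα⟩ := dual ν hν0
    intro w hw
    simpa [hα] using hB.combination_smul_left h₁ h₂ hP hQ hΦ hbil α hw hν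
  obtain ⟨ν₁, hν₁⟩ := ν₁
  obtain ⟨ν₂, hν₂⟩ := ν₂
  obtain ⟨ξ, hξ, rfl⟩ := h₁.exists_section hν₁
  obtain ⟨η, hη, rfl⟩ := h₂.exists_section hν₂
  rw [hb ξ hξ η hη]
  refine (Submodule.Quotient.eq _).2 ?_
  rw [hB.bracket_eq ξ (hS₁ hξ) η (hS₂ hη) u₁ u₂ hu₁ hu₂]
  convert sub_mem (hE₂ (hΛ₂ η hη u₁)) (hE₁ (hΛ₁ ξ hξ u₂)) using 1
  abel

end IsBracketModel

end BracketModel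

/-! ### Local actions in coordinates -/

section Coordinates

variable {EG EX : Type*} [NormedAddCommGroup EG] [NormedSpace ℝ EG]
  [NormedAddCommGroup EX] [NormedSpace ℝ EX]

theorem eventuallyEq_fundamentalField {F : EG × EX → EX} {e₀ : EG} {z₀ : EX}
    (hF : ContDiffAt ℝ 2 F (e₀, z₀)) (u : EG) :
    (fun z => fderiv ℝ (fun s => F (s, z)) e₀ u) =ᶠ[𝓝 z₀] fun z => fderiv ℝ F (e₀, z) (u, 0) := by
  have tZ : Filter.Tendsto (fun z : EX => (e₀, z)) (𝓝 z₀) (𝓝 (e₀, z₀)) :=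
    (Continuous.prodMk continuous_const continuous_id).tendsto' _ _ rfl
  filter_upwards [tZ.eventually (hF.eventually (by simp))] with z hz
  exact congrArg (fun M : EG →L[ℝ] EX => M u)
    ((hz.differentiableAt (by simp)).hasFDerivAt.comp e₀ (hasFDerivAt_prodMk_left e₀ z)).fderiv

/-- A fundamental field is a partial derivative of the action, so its derivative along `w` is the
mixed second derivative `F''(0, w)(u, 0)`. Brackets with fundamental fields thereby become
expressions in `F''`, to which symmetry applies. -/
theorem hasFDerivAt_fundamentalField {F : EG × EX → EX} {e₀ : EG} {z₀ : EX}
    (hF : ContDiffAt ℝ 2 F (e₀, z₀)) (u : EG) :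
    HasFDerivAt (fun z => fderiv ℝ (fun s => F (s, z)) e₀ u)
      (((fderiv ℝ (fderiv ℝ F) (e₀, z₀)).flip (u, 0)).comp (ContinuousLinearMap.inr ℝ EG EX))
      z₀ := by
  have hF' : HasFDerivAt (fderiv ℝ F) (fderiv ℝ (fderiv ℝ F) (e₀, z₀)) (e₀, z₀) :=
    ((hF.fderiv_right (m := 1) (by norm_num)).differentiableAt (by simp)).hasFDerivAt
  refine HasFDerivAt.congr_of_eventuallyEq ?_ (eventuallyEq_fundamentalField hF u)
  refine ((hF'.comp z₀ (hasFDerivAt_prodMk_right e₀ z₀)).clm_apply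
    (hasFDerivAt_const ((u, 0) : EG × EX) z₀)).congr_fderiv ?_
  refine ContinuousLinearMap.ext fun w => ?_
  simp

/-- In coordinates, the Lie derivative of a vector field `ξ` along a fundamental field is the
derivative of the field of vectors at `z₀` obtained by transporting `ξ` back. -/
theorem hasFDerivAt_transport [CompleteSpace EX] {F : EG × EX → EX} {e₀ : EG} {z₀ : EX}
    (hF : ContDiffAt ℝ 2 F (e₀, z₀)) (hone : ∀ᶠ z in 𝓝 z₀, F (e₀, z) = z)
    {ξ : EX → EX} (hξ : DifferentiableAt ℝ ξ z₀) :
    ∃ T : EG →L[ℝ] EX,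
      HasFDerivAt (fun s => (fderiv ℝ (fun z => F (s, z)) z₀).inverse (ξ (F (s, z₀)))) T e₀ ∧
      (∀ᶠ s in 𝓝 e₀, (fderiv ℝ (fun z => F (s, z)) z₀).IsInvertible) ∧
      ∀ u, lieBracket ℝ (fun z => fderiv ℝ (fun s => F (s, z)) e₀ u) ξ z₀ = T u := by
  have hFd : ∀ᶠ p in 𝓝 (e₀, z₀), DifferentiableAt ℝ F p :=
    (hF.eventually (by simp)).mono fun p hp => hp.differentiableAt (by simp)
  have hF' : HasFDerivAt (fderiv ℝ F) (fderiv ℝ (fderiv ℝ F) (e₀, z₀)) (e₀, z₀) :=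
    ((hF.fderiv_right (m := 1) (by norm_num)).differentiableAt (by simp)).hasFDerivAt
  have hsymm : IsSymmSndFDerivAt ℝ F (e₀, z₀) := hF.isSymmSndFDerivAt (by simp)
  set F'' := fderiv ℝ (fderiv ℝ F) (e₀, z₀)
  have tS : Filter.Tendsto (fun s : EG => (s, z₀)) (𝓝 e₀) (𝓝 (e₀, z₀)) :=
    (Continuous.prodMk continuous_id continuous_const).tendsto' _ _ rfl
  have dS : ∀ p, HasFDerivAt (fun s : EG => (s, (z₀ : EX))) (ContinuousLinearMap.inl ℝ EG EX) p :=
    fun p => hasFDerivAt_prodMk_left p z₀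
  have h2 : (fun s => fderiv ℝ (fun z => F (s, z)) z₀) =ᶠ[𝓝 e₀]
      fun s => (fderiv ℝ F (s, z₀)).comp (ContinuousLinearMap.inr ℝ EG EX) := by
    filter_upwards [tS.eventually hFd] with s hs
    exact (hs.hasFDerivAt.comp z₀ (hasFDerivAt_prodMk_right s z₀)).fderiv
  have hid : fderiv ℝ (fun z => F (e₀, z)) z₀ = ContinuousLinearMap.id ℝ EX := by
    rw [Filter.EventuallyEq.fderiv_eq (f := id) hone, fderiv_id]
  have hM : HasFDerivAt (fun s => fderiv ℝ (fun z => F (s, z)) z₀)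
      (((ContinuousLinearMap.compL ℝ EX (EG × EX) EX).flip
        (ContinuousLinearMap.inr ℝ EG EX)).comp (F''.comp (ContinuousLinearMap.inl ℝ EG EX))) e₀ := by
    refine HasFDerivAt.congr_of_eventuallyEq ?_ h2
    exact ((ContinuousLinearMap.compL ℝ EX (EG × EX) EX).flip
      (ContinuousLinearMap.inr ℝ EG EX)).hasFDerivAt.comp e₀ (hF'.comp e₀ (dS e₀))
  have hinv : ∀ᶠ s in 𝓝 e₀, (fderiv ℝ (fun z => F (s, z)) z₀).IsInvertible := by
    have : Set.range ((↑) : (EX ≃L[ℝ] EX) → EX →L[ℝ] EX) ∈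
        𝓝 (fderiv ℝ (fun z => F (e₀, z)) z₀) := by
      rw [hid]
      exact (ContinuousLinearEquiv.refl ℝ EX).nhds
    filter_upwards [hM.continuousAt this] with s hs
    exact hs
  have hFS : HasFDerivAt (fun s => F (s, z₀))
      ((fderiv ℝ F (e₀, z₀)).comp (ContinuousLinearMap.inl ℝ EG EX)) e₀ :=
    (hFd.self_of_nhds.hasFDerivAt).comp e₀ (dS e₀)
  have hz₀ : F (e₀, z₀) = z₀ := hone.self_of_nhds
  have hξF : HasFDerivAt (fun s => ξ (F (s, z₀)))
      ((fderiv ℝ ξ z₀).comp ((fderiv ℝ F (e₀, z₀)).comp (ContinuousLinearMap.inl ℝ EG EX))) e₀ := by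
    refine HasFDerivAt.comp e₀ (g := ξ) ?_ hFS
    rw [hz₀]
    exact hξ.hasFDerivAt
  -- Only the differentiability of the inverse is needed. The derivative of the transported vector
  -- `a(s)` will come from the product rule for `M(s) a(s) = ξ(F(s, z₀))`, where `M(s)` is the
  -- derivative of `F(s, ·)` at `z₀`.
  have hMi : DifferentiableAt ℝ (fun s => (fderiv ℝ (fun z => F (s, z)) z₀).inverse) e₀ := by
    refine DifferentiableAt.comp e₀ (g := ContinuousLinearMap.inverse) ?_ hM.differentiableAt
    rw [hid]
    exact (contDiffAt_map_inverse (n := 1) (ContinuousLinearEquiv.refl ℝ EX)).differentiableAt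
      (by simp)
  have ha := (hMi.clm_apply hξF.differentiableAt).hasFDerivAt
  set T := fderiv ℝ (fun s => (fderiv ℝ (fun z => F (s, z)) z₀).inverse (ξ (F (s, z₀)))) e₀
  refine ⟨T, ha, hinv, fun u => ?_⟩
  have hprod := hM.clm_apply ha
  have heq : (fun s => (fderiv ℝ (fun z => F (s, z)) z₀)
      ((fderiv ℝ (fun z => F (s, z)) z₀).inverse (ξ (F (s, z₀))))) =ᶠ[𝓝 e₀]
      fun s => ξ (F (s, z₀)) := by
    filter_upwards [hinv] with s hs
    exact hs.self_apply_inverse _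
  have h3 := congrArg (fun M : EG →L[ℝ] EX => M u)
    (hprod.unique (hξF.congr_of_eventuallyEq heq))
  -- As `M(e₀) = id` and `a(e₀) = ξ(z₀)`, the product rule reads `T u + F''(u, 0)(0, ξ z₀) =
  -- Dξ(u*)`. The bracket is `Dξ(u*) - F''(0, ξ z₀)(u, 0)`, which is `T u` by symmetry of `F''`.
  rw [hid] at h3
  simp [hz₀] at h3
  rw [lieBracket, (hasFDerivAt_fundamentalField hF u).fderiv, eq_sub_of_add_eq h3,
    show fderiv ℝ (fun s => F (s, z₀)) e₀ u = _ from
      (eventuallyEq_fundamentalField hF u).self_of_nhds]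
  change _ - F'' (0, ξ z₀) (u, 0) = _
  rw [hsymm (0, ξ z₀) (u, 0)]

/-- In coordinates, the bracket of fundamental fields, in terms of the invariant fields of the
group. -/
theorem lieBracket_fundamentalField {F : EG × EX → EX} {m : EG × EG → EG} {e₀ : EG} {z₀ : EX}
    (hF : ContDiffAt ℝ 2 F (e₀, z₀)) (hm : ContDiffAt ℝ 2 m (e₀, e₀)) (hz₀ : F (e₀, z₀) = z₀)
    (hml : ∀ᶠ s in 𝓝 e₀, m (s, e₀) = s) (hmr : ∀ᶠ s in 𝓝 e₀, m (e₀, s) = s)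
    (hmul : ∀ᶠ p : EG × EG in 𝓝 (e₀, e₀), F (m p, z₀) = F (p.1, F (p.2, z₀))) (u v : EG) :
    lieBracket ℝ (fun z => fderiv ℝ (fun s => F (s, z)) e₀ u)
        (fun z => fderiv ℝ (fun s => F (s, z)) e₀ v) z₀ =
      - fderiv ℝ (fun s => F (s, z₀)) e₀ (lieBracket ℝ (fun s => fderiv ℝ (fun t => m (s, t)) e₀ u)
        (fun s => fderiv ℝ (fun t => m (s, t)) e₀ v) e₀) := by
  have hFd : ∀ᶠ p in 𝓝 (e₀, z₀), DifferentiableAt ℝ F p :=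
    (hF.eventually (by simp)).mono fun p hp => hp.differentiableAt (by simp)
  have hmd : ∀ᶠ p in 𝓝 (e₀, e₀), DifferentiableAt ℝ m p :=
    (hm.eventually (by simp)).mono fun p hp => hp.differentiableAt (by simp)
  have hF' : HasFDerivAt (fderiv ℝ F) (fderiv ℝ (fderiv ℝ F) (e₀, z₀)) (e₀, z₀) :=
    ((hF.fderiv_right (m := 1) (by norm_num)).differentiableAt (by simp)).hasFDerivAt
  have hm' : DifferentiableAt ℝ (fderiv ℝ m) (e₀, e₀) :=
    (hm.fderiv_right (m := 1) (by norm_num)).differentiableAt (by simp)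
  have hsymm : IsSymmSndFDerivAt ℝ F (e₀, z₀) := hF.isSymmSndFDerivAt (by simp)
  set F'' := fderiv ℝ (fderiv ℝ F) (e₀, z₀)
  have tS : Filter.Tendsto (fun s : EG => (s, z₀)) (𝓝 e₀) (𝓝 (e₀, z₀)) :=
    (Continuous.prodMk continuous_id continuous_const).tendsto' _ _ rfl
  have tG : Filter.Tendsto (fun s : EG => (s, e₀)) (𝓝 e₀) (𝓝 (e₀, e₀)) :=
    (Continuous.prodMk continuous_id continuous_const).tendsto' _ _ rfl
  -- the invariant fields are differentiable
  have hL : ∀ w, DifferentiableAt ℝ (fun s => fderiv ℝ (fun t => m (s, t)) e₀ w) e₀ := by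
    intro w
    have h1 : (fun s => fderiv ℝ (fun t => m (s, t)) e₀ w) =ᶠ[𝓝 e₀]
        fun s => fderiv ℝ m (s, e₀) (0, w) := by
      filter_upwards [tG.eventually hmd] with s hs
      exact congrArg (fun M : EG →L[ℝ] EG => M w)
        (hs.hasFDerivAt.comp e₀ (hasFDerivAt_prodMk_right s e₀)).fderiv
    refine DifferentiableAt.congr_of_eventuallyEq ?_ h1
    exact (DifferentiableAt.comp (g := fderiv ℝ m) (f := fun s : EG => (s, e₀)) e₀ hm'
      (hasFDerivAt_prodMk_left e₀ e₀).differentiableAt).clm_apply (differentiableAt_const _)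
  have hL0 : ∀ w, fderiv ℝ (fun t => m (e₀, t)) e₀ w = w := by
    intro w
    rw [Filter.EventuallyEq.fderiv_eq (f := id) hmr, fderiv_id, ContinuousLinearMap.id_apply]
  have hfund : ∀ w, fderiv ℝ (fun s => F (s, z₀)) e₀ w = fderiv ℝ F (e₀, z₀) (w, 0) := fun w =>
    (eventuallyEq_fundamentalField hF w).self_of_nhds
  -- derivative of the action law with respect to the second group variable
  have hlaw : ∀ w, (fun s => fderiv ℝ F (s, z₀) (fderiv ℝ (fun t => m (s, t)) e₀ w, 0)) =ᶠ[𝓝 e₀]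
      fun s => fderiv ℝ F (s, z₀) (0, fderiv ℝ F (e₀, z₀) (w, 0)) := by
    intro w
    filter_upwards [tG.eventually hmul.eventually_nhds, tS.eventually hFd, tG.eventually hmd, hml]
      with s hs hFs hms hse
    have tT : Filter.Tendsto (fun t : EG => (s, t)) (𝓝 e₀) (𝓝 (s, e₀)) :=
      (Continuous.prodMk continuous_const continuous_id).tendsto' _ _ rfl
    have d1 : HasFDerivAt (fun t => F (m (s, t), z₀)) ((fderiv ℝ F (s, z₀)).comp
        ((ContinuousLinearMap.inl ℝ EG EX).comp (fderiv ℝ (fun t => m (s, t)) e₀))) e₀ := by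
      refine HasFDerivAt.comp e₀ (g := F) (f := fun t => (m (s, t), z₀)) (by
        simpa only [hse] using hFs.hasFDerivAt) ?_
      have : HasFDerivAt (fun t => m (s, t)) (fderiv ℝ (fun t => m (s, t)) e₀) e₀ :=
        (DifferentiableAt.comp (g := m) e₀ hms
          (hasFDerivAt_prodMk_right s e₀).differentiableAt).hasFDerivAt
      exact HasFDerivAt.comp e₀ (hasFDerivAt_prodMk_left _ z₀) this
    have d2 : HasFDerivAt (fun t => F (s, F (t, z₀))) ((fderiv ℝ F (s, z₀)).comp
        ((ContinuousLinearMap.inr ℝ EG EX).comp ((fderiv ℝ F (e₀, z₀)).comp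
          (ContinuousLinearMap.inl ℝ EG EX)))) e₀ := by
      refine HasFDerivAt.comp e₀ (g := F) (f := fun t => (s, F (t, z₀))) (by
        simpa only [hz₀] using hFs.hasFDerivAt) ?_
      exact HasFDerivAt.comp e₀ (hasFDerivAt_prodMk_right s _)
        (hFd.self_of_nhds.hasFDerivAt.comp e₀ (hasFDerivAt_prodMk_left e₀ z₀))
    exact congrArg (fun M : EG →L[ℝ] EX => M w)
      (d1.unique (d2.congr_of_eventuallyEq (tT.eventually hs)))
  -- derivative with respect to the first group variable
  have hF'S : HasFDerivAt (fun s => fderiv ℝ F (s, z₀))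
      (F''.comp (ContinuousLinearMap.inl ℝ EG EX)) e₀ :=
    HasFDerivAt.comp e₀ (g := fderiv ℝ F) (f := fun s : EG => (s, z₀)) hF'
      (hasFDerivAt_prodMk_left e₀ z₀)
  have hsnd : ∀ w w' : EG, F'' (w', 0) (w, 0) + fderiv ℝ F (e₀, z₀)
        (fderiv ℝ (fun s => fderiv ℝ (fun t => m (s, t)) e₀ w) e₀ w', 0) =
      F'' (w', 0) (0, fderiv ℝ F (e₀, z₀) (w, 0)) := by
    intro w w'
    have d1 := hF'S.clm_apply (HasFDerivAt.comp e₀ (hasFDerivAt_prodMk_left _ (0 : EX))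
      (hL w).hasFDerivAt)
    have d2 := hF'S.clm_apply (hasFDerivAt_const ((0 : EG), fderiv ℝ F (e₀, z₀) (w, 0)) e₀)
    have := congrArg (fun M : EG →L[ℝ] EX => M w')
      (d1.unique (d2.congr_of_eventuallyEq (hlaw w)))
    simp [hL0] at this
    rw [add_comm]
    exact this
  rw [hfund, lieBracket, lieBracket, (hasFDerivAt_fundamentalField hF u).fderiv,
    (hasFDerivAt_fundamentalField hF v).fderiv, hfund, hfund, hL0, hL0]
  change F'' (0, fderiv ℝ F (e₀, z₀) (u, 0)) (v, 0) - F'' (0, fderiv ℝ F (e₀, z₀) (v, 0)) (u, 0) = _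
  rw [hsymm (0, _) (v, 0), hsymm (0, _) (u, 0)]
  change F'' (v, 0) _ - F'' (u, 0) _ = _
  -- With `L_w` the left-invariant field of `w`, the bracket is the difference of the identities
  -- `hsnd` for `(u, v)` and `(v, u)`. The pure group derivatives `F''(v, 0)(u, 0)` cancel by
  -- symmetry, and what is left is the image of `DL_u(v) - DL_v(u) = -[L_u, L_v]`.
  rw [← hsnd, ← hsnd, show F'' (v, 0) (u, 0) = F'' (u, 0) (v, 0) from hsymm _ _, ← map_neg]
  rw [add_sub_add_left_eq_sub, ← map_sub]
  congr 1
  ext <;> simp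

end Coordinates

/-! ### Vector fields in charts -/

section Charts

variable {E : Type*} [NormedAddCommGroup E] [NormedSpace ℝ E]
  {M : Type*} [TopologicalSpace M] [ChartedSpace E M]
  {E' : Type*} [NormedAddCommGroup E'] [NormedSpace ℝ E']
  {M' : Type*} [TopologicalSpace M'] [ChartedSpace E' M']

/-- The coordinate expression of a vector field in the preferred chart at `x`. -/
noncomputable def chartField (x : M) (ξ : ∀ y : M, TangentSpace 𝓘(ℝ, E) y) (z : E) : E :=
  mfderiv 𝓘(ℝ, E) 𝓘(ℝ, E) (extChartAt 𝓘(ℝ, E) x) ((extChartAt 𝓘(ℝ, E) x).symm z)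
    (ξ ((extChartAt 𝓘(ℝ, E) x).symm z))

theorem mfderiv_eq_fderiv_comp_extChartAt_symm {f : M → E'} {x : M}
    (hf : MDifferentiableAt 𝓘(ℝ, E) 𝓘(ℝ, E') f x) :
    mfderiv 𝓘(ℝ, E) 𝓘(ℝ, E') f x =
      fderiv ℝ (f ∘ (extChartAt 𝓘(ℝ, E) x).symm) (extChartAt 𝓘(ℝ, E) x x) := by
  simp only [mfderiv, hf, modelWithCornersSelf_coe, Set.range_id, fderivWithin_univ]
  rfl

/-- `S` is the kernel of a continuous projection `p` onto a complement; `p ∘ f` vanishes near `x`,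
so its derivative `p ∘ f'` is zero. -/
theorem HasFDerivAt.apply_mem_of_eventually_mem {W : Type*} [NormedAddCommGroup W]
    [NormedSpace ℝ W] [FiniteDimensional ℝ W] {f : E → W} {f' : E →L[ℝ] W} {x : E}
    (hf : HasFDerivAt f f' x) {S : Submodule ℝ W} (hS : ∀ᶠ s in 𝓝 x, f s ∈ S) (u : E) :
    f' u ∈ S := by
  obtain ⟨q, hq⟩ := S.exists_isCompl
  let p : W →ₗ[ℝ] q := q.projectionOnto S hq.symm
  have hp : ∀ w, p w = 0 ↔ w ∈ S := fun w => by
    rw [← LinearMap.mem_ker, Submodule.ker_projectionOnto hq.symm]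
  have h1 := (LinearMap.toContinuousLinearMap p).hasFDerivAt.comp x hf
  have h2 : (LinearMap.toContinuousLinearMap p ∘ f) =ᶠ[𝓝 x] fun _ => 0 :=
    hS.mono fun s hs => (hp _).2 hs
  have h3 := h1.unique ((hasFDerivAt_const (0 : q) x).congr_of_eventuallyEq h2)
  exact (hp _).1 (congrArg (fun L : E →L[ℝ] q => L u) h3)

theorem extChartAt_symm_eventually_mem (x : M) {p : M → Prop} (hp : ∀ᶠ y in 𝓝 x, p y) :
    ∀ᶠ z in 𝓝 (extChartAt 𝓘(ℝ, E) x x), p ((extChartAt 𝓘(ℝ, E) x).symm z) := by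
  have := continuousAt_extChartAt_symm (I := 𝓘(ℝ, E)) x
  rw [ContinuousAt, extChartAt_to_inv] at this
  exact this.eventually hp

/-- The target point is a separate variable `y'` with `f x = y'`, so that base points like `1 · y`
and `g * 1` can be replaced by `y` and `g`. -/
theorem mfderiv_extChartAt_mfderiv [IsManifold 𝓘(ℝ, E') ∞ M'] {f : M → M'} {x : M} {x' y' : M'}
    (hf : MDifferentiableAt 𝓘(ℝ, E) 𝓘(ℝ, E') f x) (hy : f x = y')
    (hy' : y' ∈ (chartAt E' x').source) (v : TangentSpace 𝓘(ℝ, E) x) :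
    (mfderiv 𝓘(ℝ, E') 𝓘(ℝ, E') (extChartAt 𝓘(ℝ, E') x') y' : E' →L[ℝ] E')
        (mfderiv 𝓘(ℝ, E) 𝓘(ℝ, E') f x v) =
      fderiv ℝ (fun z => extChartAt 𝓘(ℝ, E') x' (f ((extChartAt 𝓘(ℝ, E) x).symm z)))
        (extChartAt 𝓘(ℝ, E) x x) v := by
  subst hy
  have hφ : MDifferentiableAt 𝓘(ℝ, E') 𝓘(ℝ, E') (extChartAt 𝓘(ℝ, E') x') (f x) :=
    mdifferentiableAt_extChartAt hy'
  have h1 := mfderiv_comp x hφ hf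
  rw [mfderiv_eq_fderiv_comp_extChartAt_symm (hφ.comp x hf)] at h1
  exact congrArg (fun L : E →L[ℝ] E' => L v) h1.symm

variable [IsManifold 𝓘(ℝ, E) ∞ M]

theorem mpullbackWithin_eventuallyEq_chartField (x : M) (ξ : ∀ y : M, TangentSpace 𝓘(ℝ, E) y) :
    mpullbackWithin 𝓘(ℝ, E) 𝓘(ℝ, E) (extChartAt 𝓘(ℝ, E) x).symm ξ (Set.range 𝓘(ℝ, E)) =ᶠ[
      𝓝 (extChartAt 𝓘(ℝ, E) x x)] chartField x ξ := by
  filter_upwards [extChartAt_target_mem_nhds (I := 𝓘(ℝ, E)) x] with z hz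
  rw [mpullbackWithin_apply]
  have := ContinuousLinearMap.inverse_eq
    (mfderivWithin_extChartAt_symm_comp_mfderiv_extChartAt (I := 𝓘(ℝ, E)) (x := x) hz)
    (mfderiv_extChartAt_comp_mfderivWithin_extChartAt_symm (I := 𝓘(ℝ, E)) (x := x) hz)
  rw [this]
  rfl

/-- The differential at `x` of the preferred chart at `x` is the identity of the model space, so
pulling the coordinate bracket back to `x` leaves it unchanged. -/
theorem mlieBracket_eq_lieBracket_chartField (x : M) (ξ η : ∀ y : M, TangentSpace 𝓘(ℝ, E) y) :
    mlieBracket 𝓘(ℝ, E) ξ η x =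
      lieBracket ℝ (chartField x ξ) (chartField x η) (extChartAt 𝓘(ℝ, E) x x) := by
  rw [← mlieBracketWithin_univ, mlieBracketWithin_apply]
  have hid : (mfderiv 𝓘(ℝ, E) 𝓘(ℝ, E) (extChartAt 𝓘(ℝ, E) x) x).inverse =
      ContinuousLinearMap.id ℝ E :=
    (congrArg ContinuousLinearMap.inverse (mfderiv_extChartAt_self (I := 𝓘(ℝ, E)) (x := x))).trans
      ContinuousLinearMap.inverse_id
  refine (congrArg (fun L : E →L[ℝ] E => L _) hid).trans ?_
  refine Eq.trans ?_ ((mpullbackWithin_eventuallyEq_chartField x ξ).lieBracket_vectorField_eq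
    (𝕜 := ℝ) (mpullbackWithin_eventuallyEq_chartField x η))
  have aux : ∀ (V W : E → E) (s : Set E) (z : E), s = Set.univ →
      lieBracketWithin ℝ V W s z = lieBracket ℝ V W z := by
    rintro V W s z rfl
    rw [lieBracketWithin_univ]
  exact aux _ _ _ _ (by simp)

theorem differentiableAt_chartField [CompleteSpace E] {x : M} {ξ : ∀ y : M, TangentSpace 𝓘(ℝ, E) y}
    (hξ : MDifferentiableAt 𝓘(ℝ, E) 𝓘(ℝ, E).tangent
      (fun y => (⟨y, ξ y⟩ : TangentBundle 𝓘(ℝ, E) M)) x) :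
    DifferentiableAt ℝ (chartField x ξ) (extChartAt 𝓘(ℝ, E) x x) := by
  have := MDifferentiableWithinAt.differentiableWithinAt_mpullbackWithin_vectorField
    (mdifferentiableWithinAt_univ.2 hξ)
  simp only [Set.preimage_univ, Set.univ_inter, modelWithCornersSelf_coe, Set.range_id] at this
  have h' : DifferentiableAt ℝ (E := E) (F := E) _ (extChartAt 𝓘(ℝ, E) x x) :=
    differentiableWithinAt_univ.1 this
  exact h'.congr_of_eventuallyEq (by
    simpa using (mpullbackWithin_eventuallyEq_chartField x ξ).symm)

theorem trivializationAt_tangent_apply {x y : M} (hy : y ∈ (chartAt E x).source)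
    (v : TangentSpace 𝓘(ℝ, E) y) :
    (trivializationAt E (TangentSpace 𝓘(ℝ, E)) x ⟨y, v⟩).2 =
      mfderiv 𝓘(ℝ, E) 𝓘(ℝ, E) (extChartAt 𝓘(ℝ, E) x) y v := by
  refine Eq.trans ?_ (congrArg (fun L : E →L[ℝ] E => L v)
    (TangentBundle.continuousLinearMapAt_trivializationAt (I := 𝓘(ℝ, E)) hy))
  change _ = Bundle.Trivialization.continuousLinearMapAt ℝ
    (trivializationAt E (TangentSpace 𝓘(ℝ, E)) x) y v
  rw [Bundle.Trivialization.continuousLinearMapAt_apply, Bundle.Trivialization.linearMapAt_apply,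
    if_pos (by simpa using hy)]

theorem mdifferentiableAt_of_chartField {x : M} {ξ : ∀ y : M, TangentSpace 𝓘(ℝ, E) y}
    (hξ : DifferentiableAt ℝ (chartField x ξ) (extChartAt 𝓘(ℝ, E) x x)) :
    MDifferentiableAt 𝓘(ℝ, E) 𝓘(ℝ, E).tangent
      (fun y => (⟨y, ξ y⟩ : TangentBundle 𝓘(ℝ, E) M)) x := by
  refine (mdifferentiableAt_section (F := E) (E := TangentSpace 𝓘(ℝ, E)) 𝓘(ℝ, E) ξ).2 ?_
  have h1 : MDifferentiableAt 𝓘(ℝ, E) 𝓘(ℝ, E)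
      (fun y => chartField x ξ (extChartAt 𝓘(ℝ, E) x y)) x :=
    hξ.mdifferentiableAt.comp x (mdifferentiableAt_extChartAt (mem_chart_source E x))
  refine h1.congr_of_eventuallyEq ?_
  filter_upwards [(chartAt E x).open_source.mem_nhds (mem_chart_source E x)] with y hy
  rw [trivializationAt_tangent_apply hy, chartField,
    (extChartAt 𝓘(ℝ, E) x).left_inv (by simpa using hy)]

end Charts

/-! ### Fundamental fields of local actions -/

namespace LocalAction

variable {EG EX G X : Type*}
  [NormedAddCommGroup EG] [NormedSpace ℝ EG]
  [NormedAddCommGroup EX] [NormedSpace ℝ EX]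
  [TopologicalSpace G] [ChartedSpace EG G] [Group G]
  [TopologicalSpace X] [ChartedSpace EX X]

/-- The coordinate expression of a local action near `(1, x)`. -/
noncomputable def chartAct (A : LocalAction EG EX G X) (x : X) (p : EG × EX) : EX :=
  extChartAt 𝓘(ℝ, EX) x (A.act ((extChartAt 𝓘(ℝ, EG) (1 : G)).symm p.1)
    ((extChartAt 𝓘(ℝ, EX) x).symm p.2))

section

variable (A : LocalAction EG EX G X)

theorem contMDiffAt {g : G} {y : X} (h : (g, y) ∈ A.domain) :
    ContMDiffAt (𝓘(ℝ, EG).prod 𝓘(ℝ, EX)) 𝓘(ℝ, EX) ∞ (fun p : G × X => A.act p.1 p.2) (g, y) :=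
  A.smooth.contMDiffAt (A.isOpen_domain.mem_nhds h)

theorem eventually_mem_domain (x : X) : ∀ᶠ p : G × X in 𝓝 (1, x), p ∈ A.domain :=
  A.isOpen_domain.mem_nhds (A.one_mem x)

theorem tendsto_act (x : X) :
    Filter.Tendsto (fun p : G × X => A.act p.1 p.2) (𝓝 (1, x)) (𝓝 x) := by
  have := (A.contMDiffAt (A.one_mem x)).continuousAt
  rwa [ContinuousAt, A.one_act] at this

theorem mdifferentiableAt_orbit {g : G} {y : X} (h : (g, y) ∈ A.domain) :
    MDifferentiableAt 𝓘(ℝ, EG) 𝓘(ℝ, EX) (fun g => A.act g y) g := by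
  have : ContMDiffAt 𝓘(ℝ, EG) 𝓘(ℝ, EX) ∞ (fun g => A.act g y) g :=
    ContMDiffAt.comp (x := g) (g := fun p : G × X => A.act p.1 p.2) (f := fun g => (g, y))
      (A.contMDiffAt h) (contMDiffAt_id.prodMk contMDiffAt_const)
  exact this.mdifferentiableAt (by simp)

theorem mdifferentiableAt_act {g : G} {y : X} (h : (g, y) ∈ A.domain) :
    MDifferentiableAt 𝓘(ℝ, EX) 𝓘(ℝ, EX) (A.act g) y := by
  have : ContMDiffAt 𝓘(ℝ, EX) 𝓘(ℝ, EX) ∞ (A.act g) y :=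
    ContMDiffAt.comp (x := y) (g := fun p : G × X => A.act p.1 p.2) (f := fun y => (g, y))
      (A.contMDiffAt h) (contMDiffAt_const.prodMk contMDiffAt_id)
  exact this.mdifferentiableAt (by simp)

theorem chartAct_one (x : X) : ∀ᶠ z in 𝓝 (extChartAt 𝓘(ℝ, EX) x x),
    A.chartAct x (extChartAt 𝓘(ℝ, EG) (1 : G) 1, z) = z := by
  filter_upwards [extChartAt_target_mem_nhds (I := 𝓘(ℝ, EX)) x] with z hz
  rw [chartAct, extChartAt_to_inv, A.one_act, (extChartAt 𝓘(ℝ, EX) x).right_inv hz]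

theorem contDiffAt_chartAct (x : X) :
    ContDiffAt ℝ 2 (A.chartAct x)
      (extChartAt 𝓘(ℝ, EG) (1 : G) 1, extChartAt 𝓘(ℝ, EX) x x) := by
  have h1 : ContMDiffAt (𝓘(ℝ, EG).prod 𝓘(ℝ, EX)) 𝓘(ℝ, EX) ∞
      (fun p : G × X => extChartAt 𝓘(ℝ, EX) x (A.act p.1 p.2)) (1, x) := by
    refine ContMDiffAt.comp (1, x) (g := extChartAt 𝓘(ℝ, EX) x) ?_ (A.contMDiffAt (A.one_mem x))
    simpa only [A.one_act] using contMDiffAt_extChartAt (I := 𝓘(ℝ, EX)) (x := x) (n := ∞)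
  have h2 := (contMDiffAt_iff.1 h1).2
  simp only [extChartAt_prod, ModelWithCorners.range_eq_univ, contDiffWithinAt_univ] at h2
  exact h2.of_le ENat.LEInfty.out

variable [IsManifold 𝓘(ℝ, EX) ∞ X]

theorem chartField_orbitDiff_eventuallyEq (x : X) (u : GroupLieAlgebra 𝓘(ℝ, EG) G) :
    chartField x (fun y => A.orbitDiff y u) =ᶠ[𝓝 (extChartAt 𝓘(ℝ, EX) x x)]
      fun z => fderiv ℝ (fun s => A.chartAct x (s, z)) (extChartAt 𝓘(ℝ, EG) (1 : G) 1) u := by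
  filter_upwards [extChartAt_symm_eventually_mem x
    ((chartAt EX x).open_source.mem_nhds (mem_chart_source EX x))] with z hz
  exact mfderiv_extChartAt_mfderiv (A.mdifferentiableAt_orbit (A.one_mem _)) (A.one_act _) hz u

/-- The fundamental fields are differentiable. -/
theorem mdifferentiableAt_orbitDiff (x : X) (u : GroupLieAlgebra 𝓘(ℝ, EG) G) :
    MDifferentiableAt 𝓘(ℝ, EX) 𝓘(ℝ, EX).tangent
      (fun y => (⟨y, A.orbitDiff y u⟩ : TangentBundle 𝓘(ℝ, EX) X)) x :=
  mdifferentiableAt_of_chartField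
    ((hasFDerivAt_fundamentalField (A.contDiffAt_chartAct x) u).differentiableAt.congr_of_eventuallyEq
      (A.chartField_orbitDiff_eventuallyEq x u))

/-- A linear condition satisfied by the vectors at `x` obtained by transporting back vector fields
by the local transformations is satisfied by their Lie derivatives along fundamental fields. -/
theorem mlieBracket_orbitDiff_mem [FiniteDimensional ℝ EX] (x : X) {ι : Type*} [Fintype ι]
    {ξ : ι → ∀ y : X, TangentSpace 𝓘(ℝ, EX) y}
    (hξ : ∀ i, MDifferentiableAt 𝓘(ℝ, EX) 𝓘(ℝ, EX).tangent
      (fun y => (⟨y, ξ i y⟩ : TangentBundle 𝓘(ℝ, EX) X)) x)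
    (S : Submodule ℝ (ι → TangentSpace 𝓘(ℝ, EX) x))
    (hS : ∀ᶠ g : G in 𝓝 1, ∀ a : ι → TangentSpace 𝓘(ℝ, EX) x,
      (∀ i, A.diff g x (a i) = ξ i (A.act g x)) → a ∈ S)
    (u : GroupLieAlgebra 𝓘(ℝ, EG) G) :
    (fun i => mlieBracket 𝓘(ℝ, EX) (fun y => A.orbitDiff y u) (ξ i) x) ∈ S := by
  have : CompleteSpace EX := FiniteDimensional.complete ℝ EX
  set e₀ := extChartAt 𝓘(ℝ, EG) (1 : G) 1 with he₀
  set z₀ := extChartAt 𝓘(ℝ, EX) x x with hz₀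
  choose T hT hinv hbr using fun i => hasFDerivAt_transport (A.contDiffAt_chartAct x)
    (A.chartAct_one x) (differentiableAt_chartField (hξ i))
  -- The vectors at `x` obtained by transporting the fields back from `s · x`, in coordinates; by
  -- `hasFDerivAt_transport` their derivatives are the brackets in question.
  let a : EG → ι → EX := fun s i => (fderiv ℝ (fun z => A.chartAct x (s, z)) z₀).inverse
    (chartField x (ξ i) (A.chartAct x (s, z₀)))
  have ha : HasFDerivAt a (ContinuousLinearMap.pi T) e₀ := hasFDerivAt_pi.2 hT
  have htend : Filter.Tendsto (extChartAt 𝓘(ℝ, EG) (1 : G)).symm (𝓝 e₀) (𝓝 1) := by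
    have := continuousAt_extChartAt_symm (I := 𝓘(ℝ, EG)) (1 : G)
    rwa [ContinuousAt, extChartAt_to_inv] at this
  have hpair : Filter.Tendsto (fun g : G => (g, x)) (𝓝 1) (𝓝 (1, x)) :=
    (Continuous.prodMk continuous_id continuous_const).tendsto' _ _ rfl
  let S' : Submodule ℝ (ι → EX) := S
  have haS : ∀ᶠ s in 𝓝 e₀, a s ∈ S' := by
    -- Invertibility of the differentials was obtained along with each field, so one index is needed
    -- to have it at all.
    rcases isEmpty_or_nonempty ι with hι | ⟨⟨i₀⟩⟩
    · exact Filter.Eventually.of_forall fun s => by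
        rw [Subsingleton.elim (a s) 0]; exact zero_mem _
    filter_upwards [hinv i₀, htend.eventually hS,
      htend.eventually (hpair.eventually (A.eventually_mem_domain x)),
      htend.eventually (hpair.eventually ((A.tendsto_act x).eventually
        ((chartAt EX x).open_source.mem_nhds (mem_chart_source EX x))))] with s hs hSs hdom hsrc
    refine hSs (a s) fun i => ?_
    have hsrc' : A.act ((extChartAt 𝓘(ℝ, EG) (1 : G)).symm s) x ∈
        (extChartAt 𝓘(ℝ, EX) x).source := by
      rw [extChartAt_source]; exact hsrc
    -- The equality of tangent vectors at `s · x` is tested in the chart at `x`, whose differential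
    -- is injective there.
    refine (isInvertible_mfderiv_extChartAt (I := 𝓘(ℝ, EX)) hsrc').injective ?_
    refine (mfderiv_extChartAt_mfderiv (A.mdifferentiableAt_act hdom) rfl hsrc (a s i)).trans ?_
    refine (hs.self_apply_inverse _).trans ?_
    have h1 : A.chartAct x (s, z₀) =
        extChartAt 𝓘(ℝ, EX) x (A.act ((extChartAt 𝓘(ℝ, EG) (1 : G)).symm s) x) := by
      rw [chartAct, hz₀, extChartAt_to_inv]
    rw [h1, chartField, (extChartAt 𝓘(ℝ, EX) x).left_inv hsrc']
  have key : ContinuousLinearMap.pi T u ∈ S' := ha.apply_mem_of_eventually_mem haS u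
  have heq : (fun i => mlieBracket 𝓘(ℝ, EX) (fun y => A.orbitDiff y u) (ξ i) x) =
      ContinuousLinearMap.pi T u := by
    funext i
    rw [mlieBracket_eq_lieBracket_chartField]
    refine Eq.trans ?_ (hbr i u)
    exact (A.chartField_orbitDiff_eventuallyEq x u).lieBracket_vectorField_eq
      (Filter.EventuallyEq.refl _ _)
  rw [heq]
  exact key

/-- The bracket of fundamental fields. -/
theorem mlieBracket_orbitDiff_orbitDiff [FiniteDimensional ℝ EG] [LieGroup 𝓘(ℝ, EG) ∞ G] (x : X)
    (u v : GroupLieAlgebra 𝓘(ℝ, EG) G) :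
    mlieBracket 𝓘(ℝ, EX) (fun y => A.orbitDiff y u) (fun y => A.orbitDiff y v) x =
      - A.orbitDiff x ⁅u, v⁆ := by
  set ψ := extChartAt 𝓘(ℝ, EG) (1 : G) with hψ
  set e₀ := ψ 1 with he₀
  set z₀ := extChartAt 𝓘(ℝ, EX) x x with hz₀
  let m : EG × EG → EG := fun p => ψ (ψ.symm p.1 * ψ.symm p.2)
  have hψe : ψ.symm e₀ = 1 := extChartAt_to_inv (I := 𝓘(ℝ, EG)) (1 : G)
  have htend : Filter.Tendsto ψ.symm (𝓝 e₀) (𝓝 1) := by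
    have := continuousAt_extChartAt_symm (I := 𝓘(ℝ, EG)) (1 : G)
    rwa [ContinuousAt, extChartAt_to_inv] at this
  have htend₂ : Filter.Tendsto (fun p : EG × EG => (ψ.symm p.1, ψ.symm p.2))
      (𝓝 (e₀, e₀)) (𝓝 (1, 1)) := by
    rw [nhds_prod_eq, nhds_prod_eq]
    exact htend.prodMap htend
  have htarget : ∀ᶠ s in 𝓝 e₀, s ∈ ψ.target := extChartAt_target_mem_nhds (I := 𝓘(ℝ, EG)) (1 : G)
  have hm : ContDiffAt ℝ 2 m (e₀, e₀) := by
    have h1 : ContMDiffAt (𝓘(ℝ, EG).prod 𝓘(ℝ, EG)) 𝓘(ℝ, EG) ∞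
        (fun p : G × G => ψ (p.1 * p.2)) (1, 1) := by
      refine ContMDiffAt.comp (1, 1) (g := ψ) ?_ (contMDiff_mul 𝓘(ℝ, EG) ∞).contMDiffAt
      simpa only [mul_one] using contMDiffAt_extChartAt (I := 𝓘(ℝ, EG)) (x := (1 : G)) (n := ∞)
    have h2 := (contMDiffAt_iff.1 h1).2
    simp only [extChartAt_prod, ModelWithCorners.range_eq_univ, contDiffWithinAt_univ] at h2
    exact h2.of_le ENat.LEInfty.out
  have hml : ∀ᶠ s in 𝓝 e₀, m (s, e₀) = s := htarget.mono fun s hs => by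
    simp only [m, hψe, mul_one, ψ.right_inv hs]
  have hmr : ∀ᶠ s in 𝓝 e₀, m (e₀, s) = s := htarget.mono fun s hs => by
    simp only [m, hψe, one_mul, ψ.right_inv hs]
  -- Near the identity all points involved stay in the charts and in the domain of the action, so
  -- the action law holds in coordinates.
  have hmul : ∀ᶠ p : EG × EG in 𝓝 (e₀, e₀),
      A.chartAct x (m p, z₀) = A.chartAct x (p.1, A.chartAct x (p.2, z₀)) := by
    have hmulG : Filter.Tendsto (fun p : G × G => p.1 * p.2) (𝓝 (1, 1)) (𝓝 1) := by
      have := (contMDiff_mul 𝓘(ℝ, EG) ∞ (G := G)).continuous.tendsto (1, 1)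
      simpa using this
    have hpair : Filter.Tendsto (fun g : G => (g, x)) (𝓝 1) (𝓝 (1, x)) :=
      (Continuous.prodMk continuous_id continuous_const).tendsto' _ _ rfl
    have hact : Filter.Tendsto (fun p : G × G => A.act p.2 x) (𝓝 (1, 1)) (𝓝 x) :=
      (A.tendsto_act x).comp (hpair.comp (continuous_snd.tendsto' _ _ rfl))
    have hact₂ : Filter.Tendsto (fun p : G × G => (p.1, A.act p.2 x)) (𝓝 (1, 1)) (𝓝 (1, x)) :=
      (continuous_fst.tendsto' ((1 : G), (1 : G)) _ rfl).prodMk_nhds hact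
    filter_upwards [htend₂.eventually (hmulG.eventually
        (extChartAt_source_mem_nhds (I := 𝓘(ℝ, EG)) (1 : G))),
      htend₂.eventually (hmulG.eventually (hpair.eventually (A.eventually_mem_domain x))),
      htend₂.eventually ((continuous_snd.tendsto' ((1 : G), (1 : G)) 1 rfl).eventually
        (hpair.eventually (A.eventually_mem_domain x))),
      htend₂.eventually (hact₂.eventually (A.eventually_mem_domain x)),
      htend₂.eventually (hact.eventually
        (extChartAt_source_mem_nhds (I := 𝓘(ℝ, EX)) x))] with p h1 h2 h3 h4 h5
    simp only [chartAct, m, hz₀, extChartAt_to_inv, ← hψ]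
    rw [ψ.left_inv h1, (extChartAt 𝓘(ℝ, EX) x).left_inv h5, A.mul_act _ _ _ h3 h4 h2]
  have hinv : ∀ w : GroupLieAlgebra 𝓘(ℝ, EG) G,
      chartField (1 : G) (mulInvariantVectorField w) =ᶠ[𝓝 e₀]
        fun s => fderiv ℝ (fun t => m (s, t)) e₀ w := by
    intro w
    filter_upwards [htend.eventually
      ((chartAt EG (1 : G)).open_source.mem_nhds (mem_chart_source EG (1 : G)))] with s hs
    exact mfderiv_extChartAt_mfderiv (f := fun h : G => ψ.symm s * h)
      (contMDiff_mul_left.contMDiffAt.mdifferentiableAt (n := ∞) (by simp)) (mul_one _) hs w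
  have horbit : ∀ w : GroupLieAlgebra 𝓘(ℝ, EG) G,
      A.orbitDiff x w = fderiv ℝ (fun s => A.chartAct x (s, z₀)) e₀ w := by
    intro w
    have h := (A.chartField_orbitDiff_eventuallyEq x w).self_of_nhds
    refine Eq.trans ?_ h
    rw [chartField, extChartAt_to_inv]
    exact (congrArg (fun L : EX →L[ℝ] EX => L (A.orbitDiff x w))
      (mfderiv_extChartAt_self (I := 𝓘(ℝ, EX)) (x := x))).symm
  have hmain := lieBracket_fundamentalField (A.contDiffAt_chartAct x) hm
    (A.chartAct_one x).self_of_nhds hml hmr hmul u v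
  rw [mlieBracket_eq_lieBracket_chartField, horbit]
  refine ((A.chartField_orbitDiff_eventuallyEq x u).lieBracket_vectorField_eq
    (A.chartField_orbitDiff_eventuallyEq x v)).trans (hmain.trans ?_)
  rw [GroupLieAlgebra.bracket_def, mlieBracket_eq_lieBracket_chartField]
  congr 2
  exact ((hinv u).lieBracket_vectorField_eq (hinv v)).symm

end

end LocalAction

/-! ### Smooth sections of subbundles -/

section Sections

variable {EX X : Type*} [NormedAddCommGroup EX] [NormedSpace ℝ EX]
  [TopologicalSpace X] [ChartedSpace EX X]

/-- The solution of a linear system with smooth coefficients and injective matrix is smooth. -/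
theorem contMDiffAt_of_sum_smul {W F J : Type*} [Fintype J] [NormedAddCommGroup W]
    [NormedSpace ℝ W] [FiniteDimensional ℝ W] [NormedAddCommGroup F] [NormedSpace ℝ F]
    [FiniteDimensional ℝ F] {ℓ : J → W →L[ℝ] ℝ} {w : J → X → F} {c : X → W} {η : X → F} {y : X}
    (hw : ∀ j, ContMDiffAt 𝓘(ℝ, EX) 𝓘(ℝ, F) ∞ (w j) y) (hη : ContMDiffAt 𝓘(ℝ, EX) 𝓘(ℝ, F) ∞ η y)
    (hinj : ∀ a : W, ∑ j, ℓ j a • w j y = 0 → a = 0)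
    (h : ∀ᶠ z in 𝓝 y, ∑ j, ℓ j (c z) • w j z = η z) :
    ContMDiffAt 𝓘(ℝ, EX) 𝓘(ℝ, W) ∞ c y := by
  have : CompleteSpace W := FiniteDimensional.complete ℝ W
  let M : X → W →L[ℝ] F := fun z => ∑ j, ContinuousLinearMap.smulRightL ℝ W F (ℓ j) (w j z)
  have hMapply : ∀ z a, M z a = ∑ j, ℓ j a • w j z := fun z a => by
    simp [M]
  have hM : ContMDiffAt 𝓘(ℝ, EX) 𝓘(ℝ, W →L[ℝ] F) ∞ M y :=
    contMDiffAt_finsetSum fun j _ =>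
      (ContinuousLinearMap.contMDiff (ContinuousLinearMap.smulRightL ℝ W F (ℓ j))).contMDiffAt.comp
        y (hw j)
  have hker : LinearMap.ker (M y).toLinearMap = ⊥ := LinearMap.ker_eq_bot'.2 fun a ha =>
    hinj a ((hMapply y a).symm.trans ha)
  obtain ⟨N, hN⟩ := LinearMap.exists_leftInverse_of_injective (M y).toLinearMap hker
  let N' : F →L[ℝ] W := LinearMap.toContinuousLinearMap N
  -- A left inverse `N'` of `M y` makes the system square: `T c = N' η` with `T y = id`. Hence `T`
  -- is invertible near `y`, and `c = T⁻¹ N' η` there.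
  let T : X → W →L[ℝ] W := fun z => N'.comp (M z)
  have hT : ContMDiffAt 𝓘(ℝ, EX) 𝓘(ℝ, W →L[ℝ] W) ∞ T y :=
    (ContinuousLinearMap.contMDiff (ContinuousLinearMap.compL ℝ W F W N')).contMDiffAt.comp y hM
  have hTy : T y = ContinuousLinearEquiv.refl ℝ W := by
    ext a
    exact congrArg (fun L : W →ₗ[ℝ] W => L a) hN
  have hTinv : ContMDiffAt 𝓘(ℝ, EX) 𝓘(ℝ, W →L[ℝ] W) ∞ (fun z => (T z).inverse) y := by
    refine ContMDiffAt.comp y (g := ContinuousLinearMap.inverse) ?_ hT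
    rw [hTy]
    exact (contDiffAt_map_inverse (ContinuousLinearEquiv.refl ℝ W)).contMDiffAt
  have hunit : ∀ᶠ z in 𝓝 y, (T z).IsInvertible := by
    have : Set.range ((↑) : (W ≃L[ℝ] W) → W →L[ℝ] W) ∈ 𝓝 (T y) := by
      rw [hTy]
      exact (ContinuousLinearEquiv.refl ℝ W).nhds
    filter_upwards [hT.continuousAt this] with z hz
    exact hz
  have hNη : ContMDiffAt 𝓘(ℝ, EX) 𝓘(ℝ, W) ∞ (fun z => N' (η z)) y :=
    (ContinuousLinearMap.contMDiff N').contMDiffAt.comp y hη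
  refine (hTinv.clm_apply hNη).congr_of_eventuallyEq ?_
  filter_upwards [h, hunit] with z hz hu
  rw [← hz, ← hMapply]
  exact (hu.inverse_apply_self (c z)).symm

theorem contMDiff_bump_smul {F : Type*} [NormedAddCommGroup F] [NormedSpace ℝ F] {U : Set X}
    (hU : IsOpen U) {χ : X → ℝ} (hχ : ContMDiff 𝓘(ℝ, EX) 𝓘(ℝ, ℝ) ∞ χ) (hsupp : tsupport χ ⊆ U)
    {f : X → F} (hf : ContMDiffOn 𝓘(ℝ, EX) 𝓘(ℝ, F) ∞ f U) :
    ContMDiff 𝓘(ℝ, EX) 𝓘(ℝ, F) ∞ (fun z => χ z • f z) := by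
  refine contMDiff_of_tsupport fun z hz => ?_
  have hzU : z ∈ U := hsupp (tsupport_smul_subset_left _ _ hz)
  exact hχ.contMDiffAt.smul (hf.contMDiffAt (hU.mem_nhds hzU))

/-- The coordinates, in the chart at `x`, of the tangent vectors at `z`. -/
noncomputable def fieldCoord (x z : X) : TangentSpace 𝓘(ℝ, EX) z →ₗ[ℝ] EX :=
  (mfderiv 𝓘(ℝ, EX) 𝓘(ℝ, EX) (extChartAt 𝓘(ℝ, EX) x) z).toLinearMap

variable [IsManifold 𝓘(ℝ, EX) ∞ X]

theorem contMDiffAt_field_iff {ξ : ∀ y : X, TangentSpace 𝓘(ℝ, EX) y} {x : X} :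
    ContMDiffAt 𝓘(ℝ, EX) 𝓘(ℝ, EX).tangent ∞
        (fun y => (⟨y, ξ y⟩ : TangentBundle 𝓘(ℝ, EX) X)) x ↔
      ContMDiffAt 𝓘(ℝ, EX) 𝓘(ℝ, EX) ∞ (fun z => fieldCoord x z (ξ z)) x := by
  refine (Bundle.contMDiffAt_section (E := TangentSpace 𝓘(ℝ, EX)) (F := EX) x).trans ?_
  refine Filter.EventuallyEq.contMDiffAt_iff ?_
  filter_upwards [(chartAt EX x).open_source.mem_nhds (mem_chart_source EX x)] with y hy
  exact trivializationAt_tangent_apply hy _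

theorem fieldCoord_self (x : X) (v : TangentSpace 𝓘(ℝ, EX) x) : fieldCoord x x v = v :=
  congrArg (fun L : EX →L[ℝ] EX => L v) (mfderiv_extChartAt_self (I := 𝓘(ℝ, EX)) (x := x))

namespace SmoothFieldOn

variable {U : Set X} {ξ η : ∀ y : X, TangentSpace 𝓘(ℝ, EX) y}

theorem zero : SmoothFieldOn EX U (fun _ => 0) :=
  (Bundle.contMDiff_zeroSection ℝ (TangentSpace 𝓘(ℝ, EX))).contMDiffOn

theorem add (hξ : SmoothFieldOn EX U ξ) (hη : SmoothFieldOn EX U η) :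
    SmoothFieldOn EX U (fun z => ξ z + η z) :=
  ContMDiffOn.add_section hξ hη

theorem sub (hξ : SmoothFieldOn EX U ξ) (hη : SmoothFieldOn EX U η) :
    SmoothFieldOn EX U (fun z => ξ z - η z) :=
  ContMDiffOn.sub_section hξ hη

theorem smul {f : X → ℝ} (hf : ContMDiff 𝓘(ℝ, EX) 𝓘(ℝ, ℝ) ∞ f) (hξ : SmoothFieldOn EX U ξ) :
    SmoothFieldOn EX U (fun z => f z • ξ z) :=
  ContMDiffOn.smul_section hf.contMDiffOn hξ

theorem bump_smul (hU : IsOpen U) {χ : X → ℝ} (hχ : ContMDiff 𝓘(ℝ, EX) 𝓘(ℝ, ℝ) ∞ χ)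
    (hsupp : tsupport χ ⊆ U) (hξ : SmoothFieldOn EX U ξ) :
    SmoothFieldOn EX Set.univ (fun z => χ z • ξ z) :=
  (ContMDiffOn.smul_section_of_tsupport hχ.contMDiffOn hU hsupp hξ).contMDiffOn

theorem contMDiffAt_fieldCoord (hξ : SmoothFieldOn EX U ξ) (hU : IsOpen U) {x : X} (hx : x ∈ U) :
    ContMDiffAt 𝓘(ℝ, EX) 𝓘(ℝ, EX) ∞ (fun z => fieldCoord x z (ξ z)) x :=
  contMDiffAt_field_iff.1 (ContMDiffOn.contMDiffAt hξ (hU.mem_nhds hx))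

theorem mdifferentiableAt (hξ : SmoothFieldOn EX Set.univ ξ) (x : X) :
    MDifferentiableAt 𝓘(ℝ, EX) 𝓘(ℝ, EX).tangent
      (fun y => (⟨y, ξ y⟩ : TangentBundle 𝓘(ℝ, EX) X)) x :=
  (ContMDiffOn.contMDiffAt hξ Filter.univ_mem).mdifferentiableAt (by simp)

end SmoothFieldOn

variable [FiniteDimensional ℝ EX]

/-- The coefficients of a smooth field in a smooth frame of a subbundle are smooth. -/
theorem contMDiffOn_frame_coeff {U : Set X} (hU : IsOpen U) {r : ℕ}
    {s : Fin r → ∀ z : X, TangentSpace 𝓘(ℝ, EX) z} (hs : ∀ i, SmoothFieldOn EX U (s i))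
    (hli : ∀ z ∈ U, LinearIndependent ℝ (fun i => s i z))
    {ξ : ∀ z : X, TangentSpace 𝓘(ℝ, EX) z} (hξ : SmoothFieldOn EX U ξ) {c : X → Fin r → ℝ}
    (hc : ∀ z ∈ U, ∑ i, c z i • s i z = ξ z) :
    ContMDiffOn 𝓘(ℝ, EX) 𝓘(ℝ, Fin r → ℝ) ∞ c U := by
  intro x hx
  refine (contMDiffAt_of_sum_smul (ℓ := fun i => ContinuousLinearMap.proj i)
    (fun i => (hs i).contMDiffAt_fieldCoord hU hx) (hξ.contMDiffAt_fieldCoord hU hx)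
    (fun a ha => ?_) ?_).contMDiffWithinAt
  · simp only [fieldCoord_self, ContinuousLinearMap.proj_apply] at ha
    exact funext (Fintype.linearIndependent_iff.1 (hli x hx) a ha)
  · filter_upwards [hU.mem_nhds hx] with z hz
    rw [← hc z hz, map_sum]
    simp

variable [T2Space X]

theorem exists_bump {U : Set X} (hU : IsOpen U) {y : X} (hy : y ∈ U) :
    ∃ χ : X → ℝ, ContMDiff 𝓘(ℝ, EX) 𝓘(ℝ, ℝ) ∞ χ ∧ tsupport χ ⊆ U ∧ χ =ᶠ[𝓝 y] 1 := by
  obtain ⟨χ, -, hχ⟩ := (SmoothBumpFunction.nhds_basis_tsupport (I := 𝓘(ℝ, EX)) y).mem_iff.1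
    (hU.mem_nhds hy)
  exact ⟨χ, χ.contMDiff, hχ, χ.eventuallyEq_one⟩

/-- Every covector is the differential of a smooth function. -/
theorem exists_contMDiff_mfderiv_eq (x : X) (α : TangentSpace 𝓘(ℝ, EX) x →ₗ[ℝ] ℝ) :
    ∃ f : X → ℝ, ContMDiff 𝓘(ℝ, EX) 𝓘(ℝ, ℝ) ∞ f ∧
      ∀ v : TangentSpace 𝓘(ℝ, EX) x, mvfderiv 𝓘(ℝ, EX) f x v = α v := by
  obtain ⟨χ, hχ, hsupp, hone⟩ := exists_bump (EX := EX) (chartAt EX x).open_source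
    (mem_chart_source EX x)
  let α' : EX →L[ℝ] ℝ := LinearMap.toContinuousLinearMap (𝕜 := ℝ) (E := EX) α
  let h : X → ℝ := fun z => α' (extChartAt 𝓘(ℝ, EX) x z)
  have hh : ContMDiffOn 𝓘(ℝ, EX) 𝓘(ℝ, ℝ) ∞ h (chartAt EX x).source :=
    (ContinuousLinearMap.contMDiff α').comp_contMDiffOn contMDiffOn_extChartAt
  refine ⟨fun z => χ z • h z, contMDiff_bump_smul (chartAt EX x).open_source hχ hsupp hh,
    fun v => ?_⟩
  have heq : (fun z => χ z • h z) =ᶠ[𝓝 x] h := by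
    filter_upwards [hone] with z hz
    simp [hz]
  have hφ : HasMFDerivAt 𝓘(ℝ, EX) 𝓘(ℝ, EX) (extChartAt 𝓘(ℝ, EX) x) x
      (ContinuousLinearMap.id ℝ EX) := by
    have := (mdifferentiableAt_extChartAt (I := 𝓘(ℝ, EX)) (mem_chart_source EX x)).hasMFDerivAt
    exact (mfderiv_extChartAt_self (I := 𝓘(ℝ, EX)) (x := x)) ▸ this
  have hd : HasMFDerivAt 𝓘(ℝ, EX) 𝓘(ℝ, ℝ) (fun z => χ z • h z) x
      (α'.comp (ContinuousLinearMap.id ℝ EX)) :=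
    (α'.hasMFDerivAt.comp x hφ).congr_of_eventuallyEq heq
  exact congrArg (fun L : EX →L[ℝ] ℝ => L v) hd.mfderiv

/-- A bump function `χ` makes global sections `χ s_i` out of a local frame. The coefficients `c_i`
of a section `ξ` are local too and need a second factor: `χ² ξ = ∑ (χ c_i) (χ s_i)`. -/
theorem hasLocalFrames_smoothSections {E : ∀ y : X, Submodule ℝ (TangentSpace 𝓘(ℝ, EX) y)}
    (hE : IsSubbundle EX E) :
    HasLocalFrames (smoothFunctions EX X ℝ) (smoothSections EX E) E where
  const_mem c := contMDiff_const
  mem ξ hξ := hξ.2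
  zero := ⟨SmoothFieldOn.zero, fun y => zero_mem _⟩
  add ξ hξ η hη := ⟨hξ.1.add hη.1, fun y => add_mem (hξ.2 y) (hη.2 y)⟩
  smul f hf ξ hξ := ⟨SmoothFieldOn.smul hf hξ.1, fun y => Submodule.smul_mem _ _ (hξ.2 y)⟩
  frame y := by
    obtain ⟨U, hU, hyU, r, s, hs, hspan⟩ := hE y
    obtain ⟨χ, hχ, hsupp, hone⟩ := exists_bump (EX := EX) hU hyU
    have hχy : χ y = 1 := hone.self_of_nhds
    have hχU : ∀ z, z ∉ U → χ z = 0 := fun z hz =>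
      image_eq_zero_of_notMem_tsupport fun h => hz (hsupp h)
    refine ⟨r, fun i z => χ z • s i z, fun i => ⟨(hs i).bump_smul hU hχ hsupp, fun z => ?_⟩,
      by simpa [hχy] using (hspan y hyU).1, by simpa [hχy] using (hspan y hyU).2,
      fun ξ hξ => ?_⟩
    · by_cases hz : z ∈ U
      · rw [← (hspan z hz).2]
        exact Submodule.smul_mem _ _ (Submodule.subset_span ⟨i, rfl⟩)
      · simp [hχU z hz]
    -- Outside `U` the coefficients are arbitrary; `χ` vanishes there.
    · have hex : ∀ z, ∃ c : Fin r → ℝ, z ∈ U → ∑ i, c i • s i z = ξ z := by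
        intro z
        by_cases hz : z ∈ U
        · have := hξ.2 z
          rw [← (hspan z hz).2] at this
          obtain ⟨c, hc⟩ := (Submodule.mem_span_range_iff_exists_fun ℝ).1 this
          exact ⟨c, fun _ => hc⟩
        · exact ⟨0, fun h => absurd h hz⟩
      choose c hc using hex
      have hcs : ContMDiffOn 𝓘(ℝ, EX) 𝓘(ℝ, Fin r → ℝ) ∞ c U :=
        contMDiffOn_frame_coeff hU hs (fun z hz => (hspan z hz).1) (hξ.1.mono (Set.subset_univ U)) hc
      refine ⟨fun z => χ z * χ z, hχ.mul hχ, fun i z => χ z • c z i, fun i => ?_, by simp [hχy],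
        fun z => ?_⟩
      · exact contMDiff_bump_smul hU hχ hsupp (contMDiffOn_pi_space.1 hcs i)
      · by_cases hz : z ∈ U
        · rw [← hc z hz, Finset.smul_sum]
          refine Finset.sum_congr rfl fun i _ => ?_
          simp only [smul_smul, smul_eq_mul]
          ring_nf
        · simp [hχU z hz]

end Sections

/-! ### Real brackets on locally homogeneous manifolds -/

namespace LocalAction

variable {EG EX G X : Type*}
  [NormedAddCommGroup EG] [NormedSpace ℝ EG]
  [NormedAddCommGroup EX] [NormedSpace ℝ EX] [FiniteDimensional ℝ EX]
  [TopologicalSpace G] [ChartedSpace EG G] [Group G]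
  [TopologicalSpace X] [ChartedSpace EX X] [IsManifold 𝓘(ℝ, EX) ∞ X]
  (A : LocalAction EG EX G X)

/-- The local transformations close to the identity are immersive. -/
theorem eventually_injective_diff (x : X) :
    ∀ᶠ g : G in 𝓝 1, Function.Injective (A.diff g x) := by
  have : CompleteSpace EX := FiniteDimensional.complete ℝ EX
  obtain ⟨-, -, hinv, -⟩ := hasFDerivAt_transport (A.contDiffAt_chartAct x) (A.chartAct_one x)
    (differentiableAt_const (0 : EX))
  have hpair : Filter.Tendsto (fun g : G => (g, x)) (𝓝 1) (𝓝 (1, x)) :=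
    (Continuous.prodMk continuous_id continuous_const).tendsto' _ _ rfl
  filter_upwards [(continuousAt_extChartAt (I := 𝓘(ℝ, EG)) (1 : G)).eventually hinv,
    extChartAt_source_mem_nhds (I := 𝓘(ℝ, EG)) (1 : G),
    hpair.eventually (A.eventually_mem_domain x),
    hpair.eventually ((A.tendsto_act x).eventually
      ((chartAt EX x).open_source.mem_nhds (mem_chart_source EX x)))] with g hg hsrc hdom hact
  refine (injective_iff_map_eq_zero _).2 fun v hv => ?_
  have h1 := mfderiv_extChartAt_mfderiv (A.mdifferentiableAt_act hdom) rfl hact v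
  rw [show mfderiv 𝓘(ℝ, EX) 𝓘(ℝ, EX) (A.act g) x v = 0 from hv, map_zero] at h1
  simp only [chartAct, (extChartAt 𝓘(ℝ, EG) (1 : G)).left_inv hsrc] at hg
  exact hg.injective (h1.symm.trans (map_zero _).symm)

/-- The Lie derivatives at `x` of a vector field along the fundamental fields. -/
noncomputable def lieAct (x : X) (ξ : ∀ y : X, TangentSpace 𝓘(ℝ, EX) y) :
    GroupLieAlgebra 𝓘(ℝ, EG) G →ₗ[ℝ] TangentSpace 𝓘(ℝ, EX) x where
  toFun u := mlieBracket 𝓘(ℝ, EX) (fun y => A.orbitDiff y u) ξ x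
  map_add' u v := by
    have : CompleteSpace EX := FiniteDimensional.complete ℝ EX
    rw [← mlieBracket_add_left (A.mdifferentiableAt_orbitDiff x u)
      (A.mdifferentiableAt_orbitDiff x v)]
    congr 1
    funext y
    exact map_add _ _ _
  map_smul' c u := by
    have : CompleteSpace EX := FiniteDimensional.complete ℝ EX
    rw [RingHom.id_apply, ← mlieBracket_const_smul_left (A.mdifferentiableAt_orbitDiff x u)]
    congr 1
    funext y
    exact map_smul _ _ _

variable {A} {x : X} {ξ η : ∀ y : X, TangentSpace 𝓘(ℝ, EX) y}

theorem lieAct_add (hξ : SmoothFieldOn EX Set.univ ξ) (hη : SmoothFieldOn EX Set.univ η)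
    (u : GroupLieAlgebra 𝓘(ℝ, EG) G) :
    A.lieAct x (fun z => ξ z + η z) u = A.lieAct x ξ u + A.lieAct x η u := by
  have : CompleteSpace EX := FiniteDimensional.complete ℝ EX
  exact mlieBracket_add_right (hξ.mdifferentiableAt x) (hη.mdifferentiableAt x)

theorem lieAct_smul {f : X → ℝ} (hf : ContMDiff 𝓘(ℝ, EX) 𝓘(ℝ, ℝ) ∞ f)
    (hξ : SmoothFieldOn EX Set.univ ξ) (u : GroupLieAlgebra 𝓘(ℝ, EG) G) :
    A.lieAct x (fun z => f z • ξ z) u =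
      f x • A.lieAct x ξ u + mvfderiv 𝓘(ℝ, EX) f x (A.orbitDiff x u) • ξ x := by
  have : CompleteSpace EX := FiniteDimensional.complete ℝ EX
  rw [add_comm]
  exact mlieBracket_smul_right (hf.contMDiffAt.mdifferentiableAt (by simp)) (hξ.mdifferentiableAt x)

theorem lieAct_sub (hξ : SmoothFieldOn EX Set.univ ξ) (hη : SmoothFieldOn EX Set.univ η)
    (u : GroupLieAlgebra 𝓘(ℝ, EG) G) :
    A.lieAct x (fun z => ξ z - η z) u = A.lieAct x ξ u - A.lieAct x η u := by
  rw [eq_sub_iff_add_eq, ← lieAct_add (hξ.sub hη) hη]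
  simp

theorem lieAct_zero : A.lieAct x (fun _ => 0) = 0 := by
  ext u
  exact congrFun (mlieBracket_zero_right (I := 𝓘(ℝ, EX)) (W := fun y => A.orbitDiff y u)) x

theorem eventually_of_eventually_prod (x : X) {p : G × X → Prop}
    (hp : ∀ᶠ q : G × X in 𝓝 (1, x), p q) : ∀ᶠ g : G in 𝓝 1, p (g, x) :=
  ((Continuous.prodMk continuous_id continuous_const).tendsto' (1 : G) ((1 : G), x) rfl).eventually
    hp

/-- Injectivity of `dg` turns `dg(E_x) = E_{g·x}` into a statement about vectors transported back to
`x`. -/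
theorem IsHomogeneousSubbundle.eventually_mem {E : ∀ y : X, Submodule ℝ (TangentSpace 𝓘(ℝ, EX) y)}
    (hE : A.IsHomogeneousSubbundle E) (x : X) :
    ∀ᶠ g : G in 𝓝 1, ∀ a : TangentSpace 𝓘(ℝ, EX) x,
      A.diff g x a ∈ E (A.act g x) → a ∈ E x := by
  filter_upwards [eventually_of_eventually_prod x (hE.2 x), A.eventually_injective_diff x]
    with g hg hinj a ha
  rw [← hg] at ha
  obtain ⟨b, hb, hba⟩ := ha
  exact hinj hba ▸ hb

/-- Transported back to `x`, the values of `ξ` stay in the fixed space `E x`, and so does their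
derivative. -/
theorem IsHomogeneousSubbundle.lieAct_mem {E : ∀ y : X, Submodule ℝ (TangentSpace 𝓘(ℝ, EX) y)}
    (hE : A.IsHomogeneousSubbundle E) (hξ : ξ ∈ smoothSections EX E)
    (u : GroupLieAlgebra 𝓘(ℝ, EG) G) : A.lieAct x ξ u ∈ E x := by
  refine A.mlieBracket_orbitDiff_mem x (ι := Unit) (ξ := fun _ => ξ)
    (fun _ => hξ.1.mdifferentiableAt x) ((E x).comap (LinearMap.proj ())) ?_ u
  filter_upwards [hE.eventually_mem x] with g hg a ha
  exact hg (a ()) (ha () ▸ hξ.2 _)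

/-- The pair `(ξ, P ξ)`, transported back to `x`, stays on the graph of `P x` by equivariance. The
graph is a linear subspace, so it contains the pair of Lie derivatives. The index `false` stands for
`ξ`, `true` for `P ξ`. -/
theorem IsEquivariantHom.lieAct_eq {E : ∀ y : X, Submodule ℝ (TangentSpace 𝓘(ℝ, EX) y)}
    {P : ∀ y : X, TangentSpace 𝓘(ℝ, EX) y →ₗ[ℝ] TangentSpace 𝓘(ℝ, EX) y}
    (hP : A.IsEquivariantHom E P) (hE : A.IsHomogeneousSubbundle E)
    (hξ : ξ ∈ smoothSections EX E) (u : GroupLieAlgebra 𝓘(ℝ, EG) G) :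
    A.lieAct x (fun z => P z (ξ z)) u = P x (A.lieAct x ξ u) := by
  let S : Submodule ℝ (Bool → TangentSpace 𝓘(ℝ, EX) x) :=
    LinearMap.eqLocus (LinearMap.proj true) (P x ∘ₗ LinearMap.proj false)
  refine A.mlieBracket_orbitDiff_mem x (ξ := fun b => if b then fun z => P z (ξ z) else ξ)
    (fun b => ?_) S ?_ u
  · cases b
    · exact hξ.1.mdifferentiableAt x
    · exact (hP.1 ξ hξ).mdifferentiableAt x
  · filter_upwards [hE.eventually_mem x, eventually_of_eventually_prod x (hP.2 x),
      A.eventually_injective_diff x] with g hg hPg hinj a ha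
    have h0 : A.diff g x (a false) = ξ (A.act g x) := ha false
    have h1 : A.diff g x (a true) = P (A.act g x) (ξ (A.act g x)) := ha true
    refine hinj (h1.trans ?_)
    rw [← h0]
    exact hPg _ (hg _ (h0 ▸ hξ.2 _))

variable [FiniteDimensional ℝ EG] [LieGroup 𝓘(ℝ, EG) ∞ G]

/-- The bracket of two vector fields at `x`, computed in the Lie algebra. -/
theorem mlieBracket_eq_orbitDiff_bracket (hξ : SmoothFieldOn EX Set.univ ξ)
    (hη : SmoothFieldOn EX Set.univ η) {u v : GroupLieAlgebra 𝓘(ℝ, EG) G}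
    (hu : A.orbitDiff x u = ξ x) (hv : A.orbitDiff x v = η x) :
    mlieBracket 𝓘(ℝ, EX) ξ η x =
      A.orbitDiff x ⁅u, v⁆ + A.lieAct x η u - A.lieAct x ξ v := by
  have : CompleteSpace EX := FiniteDimensional.complete ℝ EX
  have dξ := hξ.mdifferentiableAt x
  have dη := hη.mdifferentiableAt x
  have du := A.mdifferentiableAt_orbitDiff x u
  have dv := A.mdifferentiableAt_orbitDiff x v
  set u' : ∀ y : X, TangentSpace 𝓘(ℝ, EX) y := fun y => A.orbitDiff y u
  set v' : ∀ y : X, TangentSpace 𝓘(ℝ, EX) y := fun y => A.orbitDiff y v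
  have du' := mdifferentiableAt_neg_section du
  have dv' := mdifferentiableAt_neg_section dv
  -- Both fields `ξ - u*` and `η - v*` vanish at `x`, hence so does their bracket; the formula is
  -- its bilinear expansion.
  have h0 : mlieBracket 𝓘(ℝ, EX) (ξ + (-u')) (η + (-v')) x = 0 := by
    rw [← mlieBracketWithin_univ]
    refine mlieBracketWithin_eq_zero_of_eq_zero ?_ ?_
    · simp [u', hu]
    · simp [v', hv]
  have hneg : ∀ W : ∀ y : X, TangentSpace 𝓘(ℝ, EX) y, -W = (-1 : ℝ) • W := fun W => by simp
  rw [mlieBracket_add_left dξ du', mlieBracket_add_right dη dv', mlieBracket_add_right dη dv',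
    hneg u', hneg v', mlieBracket_const_smul_left du, mlieBracket_const_smul_right dv,
    mlieBracket_const_smul_left du, mlieBracket_const_smul_right dv,
    A.mlieBracket_orbitDiff_orbitDiff, mlieBracket_swap_apply (V := ξ) (W := v')] at h0
  change _ = _ + mlieBracket 𝓘(ℝ, EX) u' η x - mlieBracket 𝓘(ℝ, EX) v' ξ x
  rw [← sub_eq_zero, ← h0]
  module

theorem isBracketModel [T2Space X] (hA : A.IsTransitive) (x : X) :
    IsBracketModel x (smoothFunctions EX X ℝ) {ξ | SmoothFieldOn EX Set.univ ξ}
      (mlieBracket 𝓘(ℝ, EX)) (A.orbitDiff x) (A.lieAct x) where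
  surjective := hA x
  zero_mem := SmoothFieldOn.zero
  zero_bracket η := congrFun (mlieBracket_zero_left (I := 𝓘(ℝ, EX)) (W := η)) x
  zero_act := lieAct_zero
  bracket_eq ξ hξ η hη u v hu hv := mlieBracket_eq_orbitDiff_bracket hξ hη hu hv
  leibniz α := by
    obtain ⟨f, hf, hfα⟩ := exists_contMDiff_mfderiv_eq x α
    exact ⟨f, hf, fun η hη => ⟨SmoothFieldOn.smul hf hη, fun u => by
      rw [lieAct_smul hf hη, hfα]⟩⟩

end LocalAction

/-! ### Real and imaginary parts -/

section Complexification

variable {V W : Type*} [AddCommGroup V] [Module ℝ V] [AddCommGroup W] [Module ℝ W]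

theorem complexRe_tmul (c : ℂ) (v : V) : complexRe V (c ⊗ₜ v) = c.re • v := by
  simp [complexRe]

theorem complexIm_tmul (c : ℂ) (v : V) : complexIm V (c ⊗ₜ v) = c.im • v := by
  simp [complexIm]

theorem one_tmul_complexRe_add (a : ℂ ⊗[ℝ] V) :
    (1 : ℂ) ⊗ₜ complexRe V a + Complex.I ⊗ₜ complexIm V a = a := by
  induction a using TensorProduct.induction_on with
  | zero => simp
  | tmul c v =>
    rw [complexRe_tmul, complexIm_tmul, ← TensorProduct.smul_tmul, ← TensorProduct.smul_tmul,
      ← TensorProduct.add_tmul]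
    congr 1
    simp [Complex.re_add_im]
  | add a b ha hb =>
    rw [map_add, map_add, TensorProduct.tmul_add, TensorProduct.tmul_add]
    nth_rewrite 3 [← ha]
    nth_rewrite 3 [← hb]
    abel

theorem complex_ext {a b : ℂ ⊗[ℝ] V} (hr : complexRe V a = complexRe V b)
    (hi : complexIm V a = complexIm V b) : a = b := by
  rw [← one_tmul_complexRe_add a, ← one_tmul_complexRe_add b, hr, hi]

theorem complexRe_smul (c : ℂ) (a : ℂ ⊗[ℝ] V) :
    complexRe V (c • a) = c.re • complexRe V a - c.im • complexIm V a := by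
  induction a using TensorProduct.induction_on with
  | zero => simp
  | tmul d v =>
    simp only [TensorProduct.smul_tmul', complexRe_tmul, complexIm_tmul, smul_eq_mul,
      Complex.mul_re]
    module
  | add a b ha hb =>
    simp only [smul_add, map_add, ha, hb]
    abel

theorem complexIm_smul (c : ℂ) (a : ℂ ⊗[ℝ] V) :
    complexIm V (c • a) = c.re • complexIm V a + c.im • complexRe V a := by
  induction a using TensorProduct.induction_on with
  | zero => simp
  | tmul d v =>
    simp only [TensorProduct.smul_tmul', complexRe_tmul, complexIm_tmul, smul_eq_mul,
      Complex.mul_im]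
    module
  | add a b ha hb =>
    simp only [smul_add, map_add, ha, hb]
    abel

theorem complexRe_baseChange (f : V →ₗ[ℝ] W) (a : ℂ ⊗[ℝ] V) :
    complexRe W (f.baseChange ℂ a) = f (complexRe V a) := by
  induction a using TensorProduct.induction_on with
  | zero => simp
  | tmul d v => simp [complexRe_tmul]
  | add a b ha hb => simp only [map_add, ha, hb]

theorem complexIm_baseChange (f : V →ₗ[ℝ] W) (a : ℂ ⊗[ℝ] V) :
    complexIm W (f.baseChange ℂ a) = f (complexIm V a) := by
  induction a using TensorProduct.induction_on with
  | zero => simp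
  | tmul d v => simp [complexIm_tmul]
  | add a b ha hb => simp only [map_add, ha, hb]

theorem baseChange_injective {f : V →ₗ[ℝ] W} (hf : Function.Injective f) :
    Function.Injective (f.baseChange ℂ) := by
  intro a b hab
  refine complex_ext (hf ?_) (hf ?_)
  · rw [← complexRe_baseChange, ← complexRe_baseChange, hab]
  · rw [← complexIm_baseChange, ← complexIm_baseChange, hab]

section Lie

variable {𝔤 : Type*} [LieRing 𝔤] [LieAlgebra ℝ 𝔤]

/-- The same shape as `cBracket`, so that the real bracket formula can be applied to each pair of
real and imaginary parts. -/
theorem complex_lie (a b : ℂ ⊗[ℝ] 𝔤) :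
    ⁅a, b⁆ = (1 : ℂ) ⊗ₜ (⁅complexRe 𝔤 a, complexRe 𝔤 b⁆ - ⁅complexIm 𝔤 a, complexIm 𝔤 b⁆) +
      Complex.I ⊗ₜ (⁅complexRe 𝔤 a, complexIm 𝔤 b⁆ + ⁅complexIm 𝔤 a, complexRe 𝔤 b⁆) := by
  conv_lhs => rw [← one_tmul_complexRe_add a, ← one_tmul_complexRe_add b]
  simp only [add_lie, lie_add, LieAlgebra.ExtendScalars.bracket_tmul, mul_one, one_mul,
    Complex.I_mul_I, TensorProduct.tmul_sub, TensorProduct.tmul_add, TensorProduct.neg_tmul]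
  abel

theorem complexRe_lie (a b : ℂ ⊗[ℝ] 𝔤) : complexRe 𝔤 ⁅a, b⁆ =
    ⁅complexRe 𝔤 a, complexRe 𝔤 b⁆ - ⁅complexIm 𝔤 a, complexIm 𝔤 b⁆ := by
  simp [complex_lie, complexRe_tmul]

theorem complexIm_lie (a b : ℂ ⊗[ℝ] 𝔤) : complexIm 𝔤 ⁅a, b⁆ =
    ⁅complexRe 𝔤 a, complexIm 𝔤 b⁆ + ⁅complexIm 𝔤 a, complexRe 𝔤 b⁆ := by
  simp [complex_lie, complexIm_tmul]

end Lie

end Complexification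

/-! ### Smooth sections of complex subbundles -/

section CSections

variable {EX X : Type*} [NormedAddCommGroup EX] [NormedSpace ℝ EX]
  [TopologicalSpace X] [ChartedSpace EX X]

theorem contMDiff_re {f : X → ℂ} (hf : ContMDiff 𝓘(ℝ, EX) 𝓘(ℝ, ℂ) ∞ f) :
    ContMDiff 𝓘(ℝ, EX) 𝓘(ℝ, ℝ) ∞ (fun z => (f z).re) :=
  (ContinuousLinearMap.contMDiff Complex.reCLM).comp hf

theorem contMDiff_im {f : X → ℂ} (hf : ContMDiff 𝓘(ℝ, EX) 𝓘(ℝ, ℂ) ∞ f) :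
    ContMDiff 𝓘(ℝ, EX) 𝓘(ℝ, ℝ) ∞ (fun z => (f z).im) :=
  (ContinuousLinearMap.contMDiff Complex.imCLM).comp hf

theorem contMDiff_ofReal {f : X → ℝ} (hf : ContMDiff 𝓘(ℝ, EX) 𝓘(ℝ, ℝ) ∞ f) :
    ContMDiff 𝓘(ℝ, EX) 𝓘(ℝ, ℂ) ∞ (fun z => (f z : ℂ)) :=
  (ContinuousLinearMap.contMDiff Complex.ofRealCLM).comp hf

variable (ζ ϑ : ∀ y : X, CTangent EX y)

theorem fieldRe_zero : fieldRe EX (fun y : X => (0 : CTangent EX y)) = fun _ => 0 :=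
  funext fun _ => map_zero _

theorem fieldIm_zero : fieldIm EX (fun y : X => (0 : CTangent EX y)) = fun _ => 0 :=
  funext fun _ => map_zero _

theorem fieldRe_add : fieldRe EX (fun z => ζ z + ϑ z) = fun z => fieldRe EX ζ z + fieldRe EX ϑ z :=
  funext fun _ => map_add _ _ _

theorem fieldIm_add : fieldIm EX (fun z => ζ z + ϑ z) = fun z => fieldIm EX ζ z + fieldIm EX ϑ z :=
  funext fun _ => map_add _ _ _

theorem fieldRe_smul (f : X → ℂ) : fieldRe EX (fun z => f z • ζ z) =
    fun z => (f z).re • fieldRe EX ζ z - (f z).im • fieldIm EX ζ z :=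
  funext fun _ => complexRe_smul _ _

theorem fieldIm_smul (f : X → ℂ) : fieldIm EX (fun z => f z • ζ z) =
    fun z => (f z).re • fieldIm EX ζ z + (f z).im • fieldRe EX ζ z :=
  funext fun _ => complexIm_smul _ _

variable [IsManifold 𝓘(ℝ, EX) ∞ X]

namespace SmoothCFieldOn

variable {U : Set X} {ζ ϑ}

theorem zero : SmoothCFieldOn EX U (fun y : X => (0 : CTangent EX y)) := by
  rw [SmoothCFieldOn, fieldRe_zero, fieldIm_zero]
  exact ⟨SmoothFieldOn.zero, SmoothFieldOn.zero⟩

theorem add (hζ : SmoothCFieldOn EX U ζ) (hϑ : SmoothCFieldOn EX U ϑ) :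
    SmoothCFieldOn EX U (fun z => ζ z + ϑ z) := by
  rw [SmoothCFieldOn, fieldRe_add, fieldIm_add]
  exact ⟨hζ.1.add hϑ.1, hζ.2.add hϑ.2⟩

theorem smul {f : X → ℂ} (hf : ContMDiff 𝓘(ℝ, EX) 𝓘(ℝ, ℂ) ∞ f) (hζ : SmoothCFieldOn EX U ζ) :
    SmoothCFieldOn EX U (fun z => f z • ζ z) := by
  rw [SmoothCFieldOn, fieldRe_smul, fieldIm_smul]
  exact ⟨(hζ.1.smul (contMDiff_re hf)).sub (hζ.2.smul (contMDiff_im hf)),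
    (hζ.2.smul (contMDiff_re hf)).add (hζ.1.smul (contMDiff_im hf))⟩

theorem bump_smul (hU : IsOpen U) {χ : X → ℝ} (hχ : ContMDiff 𝓘(ℝ, EX) 𝓘(ℝ, ℝ) ∞ χ)
    (hsupp : tsupport χ ⊆ U) (hζ : SmoothCFieldOn EX U ζ) :
    SmoothCFieldOn EX Set.univ (fun z => (χ z : ℂ) • ζ z) := by
  rw [SmoothCFieldOn, fieldRe_smul, fieldIm_smul]
  simp only [Complex.ofReal_re, Complex.ofReal_im, zero_smul, sub_zero, add_zero]
  exact ⟨hζ.1.bump_smul hU hχ hsupp, hζ.2.bump_smul hU hχ hsupp⟩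

theorem mono {U' : Set X} (hζ : SmoothCFieldOn EX U ζ) (h : U' ⊆ U) : SmoothCFieldOn EX U' ζ :=
  ⟨ContMDiffOn.mono hζ.1 h, ContMDiffOn.mono hζ.2 h⟩

end SmoothCFieldOn

variable [FiniteDimensional ℝ EX] {ζ}

/-- The coefficients of a smooth complex field in a smooth frame of a complex subbundle are
smooth. -/
theorem contMDiffOn_cframe_coeff {U : Set X} (hU : IsOpen U) {r : ℕ}
    {s : Fin r → ∀ z : X, CTangent EX z} (hs : ∀ i, SmoothCFieldOn EX U (s i))
    (hli : ∀ z ∈ U, LinearIndependent ℂ (fun i => s i z))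
    (hζ : SmoothCFieldOn EX U ζ) {c : X → Fin r → ℂ}
    (hc : ∀ z ∈ U, ∑ i, c z i • s i z = ζ z) :
    ContMDiffOn 𝓘(ℝ, EX) 𝓘(ℝ, Fin r → ℂ) ∞ c U := by
  intro x hx
  let coord : ∀ z : X, CTangent EX z →ₗ[ℝ] EX × EX := fun z =>
    (fieldCoord x z ∘ₗ complexRe _).prod (fieldCoord x z ∘ₗ complexIm _)
  have hcoord : ∀ {ϑ : ∀ z : X, CTangent EX z}, SmoothCFieldOn EX U ϑ →
      ContMDiffAt 𝓘(ℝ, EX) 𝓘(ℝ, EX × EX) ∞ (fun z => coord z (ϑ z)) x := fun hϑ =>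
    (hϑ.1.contMDiffAt_fieldCoord hU hx).prodMk_space (hϑ.2.contMDiffAt_fieldCoord hU hx)
  -- The complex system in `r` unknowns becomes a real one in `2r` unknowns: the index `(i, false)`
  -- carries the real part of `a i` and the vector `s i`, the index `(i, true)` the imaginary part
  -- and `I • s i`.
  have hsum : ∀ z (a : Fin r → ℂ), coord z (∑ i, a i • s i z) =
      ∑ j : Fin r × Bool, (if j.2 then Complex.imCLM.comp (ContinuousLinearMap.proj j.1)
        else Complex.reCLM.comp (ContinuousLinearMap.proj j.1) : (Fin r → ℂ) →L[ℝ] ℝ) a •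
        coord z ((if j.2 then Complex.I else 1) • s j.1 z) := by
    intro z a
    rw [map_sum, Fintype.sum_prod_type]
    refine Finset.sum_congr rfl fun i _ => ?_
    simp only [Fintype.sum_bool, if_true, Bool.false_eq_true, if_false,
      ContinuousLinearMap.comp_apply, ContinuousLinearMap.proj_apply, Complex.imCLM_apply,
      Complex.reCLM_apply, ← map_smul, ← map_add]
    congr 1
    refine complex_ext ?_ ?_
    · simp [complexRe_smul]
      abel
    · simp [complexIm_smul]
      abel
  refine (contMDiffAt_of_sum_smul
    (ℓ := fun j => if j.2 then Complex.imCLM.comp (ContinuousLinearMap.proj j.1)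
      else Complex.reCLM.comp (ContinuousLinearMap.proj j.1))
    (w := fun (j : Fin r × Bool) z => coord z ((if j.2 then Complex.I else 1) • s j.1 z))
    (fun j => ?_) (hcoord hζ) (fun a ha => ?_) ?_).contMDiffWithinAt
  · exact hcoord ((hs j.1).smul (f := fun _ => if j.2 then Complex.I else 1) contMDiff_const)
  · rw [← hsum] at ha
    have h0 : ∑ i, a i • s i x = 0 := by
      refine complex_ext ?_ ?_
      · have : fieldCoord x x (complexRe _ (∑ i, a i • s i x)) = 0 := congrArg Prod.fst ha
        rwa [fieldCoord_self, ← map_zero (complexRe _)] at this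
      · have : fieldCoord x x (complexIm _ (∑ i, a i • s i x)) = 0 := congrArg Prod.snd ha
        rwa [fieldCoord_self, ← map_zero (complexIm _)] at this
    exact funext (Fintype.linearIndependent_iff.1 (hli x hx) a h0)
  · filter_upwards [hU.mem_nhds hx] with z hz
    rw [← hsum, hc z hz]

theorem hasLocalFrames_smoothCSections [T2Space X] {E : ∀ y : X, Submodule ℂ (CTangent EX y)}
    (hE : IsCSubbundle EX E) :
    HasLocalFrames (smoothFunctions EX X ℂ) (smoothCSections EX E) E where
  const_mem c := contMDiff_const
  mem ξ hξ := hξ.2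
  zero := ⟨SmoothCFieldOn.zero, fun y => zero_mem _⟩
  add ξ hξ η hη := ⟨hξ.1.add hη.1, fun y => add_mem (hξ.2 y) (hη.2 y)⟩
  smul f hf ξ hξ := ⟨SmoothCFieldOn.smul hf hξ.1, fun y => Submodule.smul_mem _ _ (hξ.2 y)⟩
  frame y := by
    obtain ⟨U, hU, hyU, r, s, hs, hspan⟩ := hE y
    obtain ⟨χ, hχ, hsupp, hone⟩ := exists_bump (EX := EX) hU hyU
    have hχy : χ y = 1 := hone.self_of_nhds
    have hχU : ∀ z, z ∉ U → χ z = 0 := fun z hz =>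
      image_eq_zero_of_notMem_tsupport fun h => hz (hsupp h)
    refine ⟨r, fun i z => (χ z : ℂ) • s i z, fun i => ⟨(hs i).bump_smul hU hχ hsupp, fun z => ?_⟩,
      by simpa [hχy] using (hspan y hyU).1, by simpa [hχy] using (hspan y hyU).2,
      fun ξ hξ => ?_⟩
    · by_cases hz : z ∈ U
      · rw [← (hspan z hz).2]
        exact Submodule.smul_mem _ _ (Submodule.subset_span ⟨i, rfl⟩)
      · simp [hχU z hz]
    · have hex : ∀ z, ∃ c : Fin r → ℂ, z ∈ U → ∑ i, c i • s i z = ξ z := by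
        intro z
        by_cases hz : z ∈ U
        · have := hξ.2 z
          rw [← (hspan z hz).2] at this
          obtain ⟨c, hc⟩ := (Submodule.mem_span_range_iff_exists_fun ℂ).1 this
          exact ⟨c, fun _ => hc⟩
        · exact ⟨0, fun h => absurd h hz⟩
      choose c hc using hex
      have hcs : ContMDiffOn 𝓘(ℝ, EX) 𝓘(ℝ, Fin r → ℂ) ∞ c U :=
        contMDiffOn_cframe_coeff hU hs (fun z hz => (hspan z hz).1)
          (hξ.1.mono (Set.subset_univ U)) hc
      refine ⟨fun z => ((χ z * χ z : ℝ) : ℂ), contMDiff_ofReal (hχ.mul hχ),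
        fun i z => χ z • c z i, fun i => ?_, by simp [hχy], fun z => ?_⟩
      · exact contMDiff_bump_smul hU hχ hsupp (contMDiffOn_pi_space.1 hcs i)
      · by_cases hz : z ∈ U
        · rw [← hc z hz, Finset.smul_sum]
          refine Finset.sum_congr rfl fun i _ => ?_
          simp only [smul_smul, Complex.real_smul, Complex.ofReal_mul]
          ring_nf
        · simp [hχU z hz]

end CSections

/-! ### Complex brackets on locally homogeneous manifolds -/

namespace LocalAction

section Isotropy

variable {EG EX G X : Type*}
  [NormedAddCommGroup EG] [NormedSpace ℝ EG] [NormedAddCommGroup EX] [NormedSpace ℝ EX]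
  [TopologicalSpace G] [ChartedSpace EG G] [Group G] [TopologicalSpace X] [ChartedSpace EX X]
  {A : LocalAction EG EX G X} {x : X}

/-- The complexified isotropy algebra is spanned over `ℂ` by real elements, which the orbit
differential kills. -/
theorem cOrbitDiff_eq_zero {h : ℂ ⊗[ℝ] GroupLieAlgebra 𝓘(ℝ, EG) G} (hh : h ∈ A.cIsotropy x) :
    A.cOrbitDiff x h = 0 := by
  have hle : A.cIsotropy x ≤ LinearMap.ker (A.cOrbitDiff x) := by
    rw [cIsotropy, Submodule.baseChange_eq_span, Submodule.span_le]
    rintro _ ⟨v, hv, rfl⟩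
    have hv' : A.orbitDiff x v = 0 := hv
    simp [cOrbitDiff, hv']
  exact hle hh

end Isotropy

variable {EG EX G X : Type*}
  [NormedAddCommGroup EG] [NormedSpace ℝ EG]
  [NormedAddCommGroup EX] [NormedSpace ℝ EX] [FiniteDimensional ℝ EX]
  [TopologicalSpace G] [ChartedSpace EG G] [Group G]
  [TopologicalSpace X] [ChartedSpace EX X] [IsManifold 𝓘(ℝ, EX) ∞ X]
  (A : LocalAction EG EX G X)

/-- The complex bilinear extension of `LocalAction.lieAct`. -/
noncomputable def cLieAct (x : X) (ζ : ∀ y : X, CTangent EX y) :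
    ℂ ⊗[ℝ] GroupLieAlgebra 𝓘(ℝ, EG) G →ₗ[ℂ] CTangent EX x :=
  (A.lieAct x (fieldRe EX ζ)).baseChange ℂ + Complex.I • (A.lieAct x (fieldIm EX ζ)).baseChange ℂ

variable {A} {x : X} {ζ : ∀ y : X, CTangent EX y}

theorem complexRe_cLieAct (u : ℂ ⊗[ℝ] GroupLieAlgebra 𝓘(ℝ, EG) G) :
    complexRe _ (A.cLieAct x ζ u) = A.lieAct x (fieldRe EX ζ) (complexRe _ u) -
      A.lieAct x (fieldIm EX ζ) (complexIm _ u) := by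
  rw [cLieAct, LinearMap.add_apply, LinearMap.smul_apply, map_add, complexRe_smul,
    complexRe_baseChange, complexRe_baseChange, complexIm_baseChange]
  simp [sub_eq_add_neg]

theorem complexIm_cLieAct (u : ℂ ⊗[ℝ] GroupLieAlgebra 𝓘(ℝ, EG) G) :
    complexIm _ (A.cLieAct x ζ u) = A.lieAct x (fieldRe EX ζ) (complexIm _ u) +
      A.lieAct x (fieldIm EX ζ) (complexRe _ u) := by
  rw [cLieAct, LinearMap.add_apply, LinearMap.smul_apply, map_add, complexIm_smul,
    complexRe_baseChange, complexIm_baseChange, complexIm_baseChange]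
  simp

theorem IsHomogeneousCSubbundle.eventually_mem {E : ∀ y : X, Submodule ℂ (CTangent EX y)}
    (hE : A.IsHomogeneousCSubbundle E) (x : X) :
    ∀ᶠ g : G in 𝓝 1, ∀ a : CTangent EX x, A.cDiff g x a ∈ E (A.act g x) → a ∈ E x := by
  filter_upwards [eventually_of_eventually_prod x (hE.2 x), A.eventually_injective_diff x]
    with g hg hinj a ha
  rw [← hg] at ha
  obtain ⟨b, hb, hba⟩ := ha
  exact baseChange_injective hinj hba ▸ hb

/-- Complex linear conditions on transported complex vectors are satisfied by Lie derivatives. -/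
theorem cLieAct_mem_of_eventually {ι : Type*} [Fintype ι] {ζ : ι → ∀ y : X, CTangent EX y}
    (hζ : ∀ i, SmoothCFieldOn EX Set.univ (ζ i)) (S : Submodule ℂ (ι → CTangent EX x))
    (hS : ∀ᶠ g : G in 𝓝 1, ∀ a : ι → CTangent EX x,
      (∀ i, A.cDiff g x (a i) = ζ i (A.act g x)) → a ∈ S)
    (u : ℂ ⊗[ℝ] GroupLieAlgebra 𝓘(ℝ, EG) G) :
    (fun i => A.cLieAct x (ζ i) u) ∈ S := by
  -- By complex linearity in `u`, real `w` suffice. For these the real statement applies to all real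
  -- and imaginary parts together, and `J` reassembles complex vectors from them.
  have hreal : ∀ w : GroupLieAlgebra 𝓘(ℝ, EG) G,
      (fun i => A.cLieAct x (ζ i) ((1 : ℂ) ⊗ₜ w)) ∈ S := by
    intro w
    let J : (ι × Bool → TangentSpace 𝓘(ℝ, EX) x) →ₗ[ℝ] ι → CTangent EX x :=
      let pr (j : ι × Bool) : (ι × Bool → TangentSpace 𝓘(ℝ, EX) x) →ₗ[ℝ]
        TangentSpace 𝓘(ℝ, EX) x := LinearMap.proj j
      LinearMap.pi fun i => TensorProduct.mk ℝ ℂ _ 1 ∘ₗ pr (i, false) +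
        TensorProduct.mk ℝ ℂ _ Complex.I ∘ₗ pr (i, true)
    have hJ : ∀ a i, J a i = (1 : ℂ) ⊗ₜ a (i, false) + Complex.I ⊗ₜ a (i, true) := fun a i => rfl
    have key := A.mlieBracket_orbitDiff_mem x
      (ξ := fun j : ι × Bool => if j.2 then fieldIm EX (ζ j.1) else fieldRe EX (ζ j.1))
      (fun j => by
        rcases j with ⟨i, b⟩
        cases b
        · exact (hζ i).1.mdifferentiableAt x
        · exact (hζ i).2.mdifferentiableAt x)
      ((S.restrictScalars ℝ).comap J) (by
        filter_upwards [hS] with g hg a ha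
        refine hg (J a) fun i => ?_
        have h0 : A.diff g x (a (i, false)) = fieldRe EX (ζ i) (A.act g x) := ha (i, false)
        have h1 : A.diff g x (a (i, true)) = fieldIm EX (ζ i) (A.act g x) := ha (i, true)
        rw [hJ, map_add, cDiff, LinearMap.baseChange_tmul, LinearMap.baseChange_tmul, h0, h1]
        exact one_tmul_complexRe_add _) w
    have key' : J _ ∈ S := key
    refine (congrArg (· ∈ S) (funext fun i => ?_)).mpr key'
    refine Eq.trans ?_ (hJ _ i).symm
    refine complex_ext ?_ ?_
    · rw [complexRe_cLieAct]
      simp [complexRe_tmul, complexIm_tmul]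
      rfl
    · rw [complexIm_cLieAct]
      simp [complexRe_tmul, complexIm_tmul]
      rfl
  have := add_mem (hreal (complexRe _ u)) (S.smul_mem Complex.I (hreal (complexIm _ u)))
  convert this using 1
  funext i
  conv_lhs => rw [← one_tmul_complexRe_add u]
  simp [← map_smul, TensorProduct.smul_tmul']

theorem IsHomogeneousCSubbundle.cLieAct_mem {E : ∀ y : X, Submodule ℂ (CTangent EX y)}
    (hE : A.IsHomogeneousCSubbundle E) (hζ : ζ ∈ smoothCSections EX E)
    (u : ℂ ⊗[ℝ] GroupLieAlgebra 𝓘(ℝ, EG) G) : A.cLieAct x ζ u ∈ E x := by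
  refine cLieAct_mem_of_eventually (ι := Unit) (ζ := fun _ => ζ) (fun _ => hζ.1)
    ((E x).comap (LinearMap.proj ())) ?_ u
  filter_upwards [hE.eventually_mem x] with g hg a ha
  exact hg (a ()) (ha () ▸ hζ.2 _)

theorem IsEquivariantCHom.cLieAct_eq {E : ∀ y : X, Submodule ℂ (CTangent EX y)}
    {P : ∀ y : X, CTangent EX y →ₗ[ℂ] CTangent EX y}
    (hP : A.IsEquivariantCHom E P) (hE : A.IsHomogeneousCSubbundle E)
    (hζ : ζ ∈ smoothCSections EX E) (u : ℂ ⊗[ℝ] GroupLieAlgebra 𝓘(ℝ, EG) G) :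
    A.cLieAct x (fun z => P z (ζ z)) u = P x (A.cLieAct x ζ u) := by
  let pr (b : Bool) : (Bool → CTangent EX x) →ₗ[ℂ] CTangent EX x := LinearMap.proj b
  let S : Submodule ℂ (Bool → CTangent EX x) := LinearMap.eqLocus (pr true) (P x ∘ₗ pr false)
  let ζ' : Bool → ∀ y : X, CTangent EX y := fun b => if b then fun z => P z (ζ z) else ζ
  have hζ' : ∀ b, SmoothCFieldOn EX Set.univ (ζ' b) := by
    rintro (_ | _)
    · exact hζ.1
    · exact hP.1 ζ hζ
  have hS : ∀ᶠ g : G in 𝓝 1, ∀ a : Bool → CTangent EX x,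
      (∀ b, A.cDiff g x (a b) = ζ' b (A.act g x)) → a ∈ S := by
    filter_upwards [hE.eventually_mem x, eventually_of_eventually_prod x (hP.2 x),
      A.eventually_injective_diff x] with g hg hPg hinj a ha
    have h0 : A.cDiff g x (a false) = ζ (A.act g x) := ha false
    have h1 : A.cDiff g x (a true) = P (A.act g x) (ζ (A.act g x)) := ha true
    refine baseChange_injective hinj (h1.trans ?_)
    rw [← h0]
    exact hPg _ (hg _ (h0 ▸ hζ.2 _))
  exact cLieAct_mem_of_eventually hζ' S hS u

variable [FiniteDimensional ℝ EG] [LieGroup 𝓘(ℝ, EG) ∞ G]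

/-- The bracket formula is the real one for the four pairs of real and imaginary parts, recombined.
-/
theorem cIsBracketModel [T2Space X] (hA : A.IsTransitive) (x : X) :
    IsBracketModel x (smoothFunctions EX X ℂ) {ζ | SmoothCFieldOn EX Set.univ ζ}
      (cBracket EX) (A.cOrbitDiff x) (A.cLieAct x) where
  surjective := LinearMap.lTensor_surjective ℂ (hA x)
  zero_mem := SmoothCFieldOn.zero
  zero_bracket η := by
    have h : ∀ ϑ : ∀ y : X, TangentSpace 𝓘(ℝ, EX) y,
        mlieBracket 𝓘(ℝ, EX) (fun _ => 0) ϑ x = 0 := fun ϑ =>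
      congrFun (mlieBracket_zero_left (I := 𝓘(ℝ, EX)) (W := ϑ)) x
    simp [cBracket, fieldRe_zero, fieldIm_zero, h]
  zero_act := by
    rw [cLieAct, fieldRe_zero, fieldIm_zero, lieAct_zero]
    simp
  bracket_eq ξ hξ η hη u v hu hv := by
    have hur : A.orbitDiff x (complexRe _ u) = fieldRe EX ξ x := by
      rw [fieldRe, ← hu, cOrbitDiff, complexRe_baseChange]
    have hui : A.orbitDiff x (complexIm _ u) = fieldIm EX ξ x := by
      rw [fieldIm, ← hu, cOrbitDiff, complexIm_baseChange]
    have hvr : A.orbitDiff x (complexRe _ v) = fieldRe EX η x := by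
      rw [fieldRe, ← hv, cOrbitDiff, complexRe_baseChange]
    have hvi : A.orbitDiff x (complexIm _ v) = fieldIm EX η x := by
      rw [fieldIm, ← hv, cOrbitDiff, complexIm_baseChange]
    rw [cBracket, mlieBracket_eq_orbitDiff_bracket hξ.1 hη.1 hur hvr,
      mlieBracket_eq_orbitDiff_bracket hξ.2 hη.2 hui hvi,
      mlieBracket_eq_orbitDiff_bracket hξ.1 hη.2 hur hvi,
      mlieBracket_eq_orbitDiff_bracket hξ.2 hη.1 hui hvr]
    refine complex_ext ?_ ?_
    · simp only [map_add, map_sub, complexRe_tmul, complexRe_cLieAct, cOrbitDiff,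
        complexRe_baseChange, complexRe_lie, Complex.one_re, Complex.I_re, one_smul, zero_smul]
      abel
    · simp only [map_add, map_sub, complexIm_tmul, complexIm_cLieAct, cOrbitDiff,
        complexIm_baseChange, complexIm_lie, Complex.one_im, Complex.I_im, one_smul, zero_smul]
      abel
  leibniz α := by
    -- A complex covector is determined by its restriction to real vectors. Realising the real and
    -- imaginary parts of this restriction as `df₁` and `df₂` at `x` gives the function `f₁ + i f₂`.
    let αre : TangentSpace 𝓘(ℝ, EX) x →ₗ[ℝ] ℝ :=
      Complex.reLm ∘ₗ α.restrictScalars ℝ ∘ₗ TensorProduct.mk ℝ ℂ _ 1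
    let αim : TangentSpace 𝓘(ℝ, EX) x →ₗ[ℝ] ℝ :=
      Complex.imLm ∘ₗ α.restrictScalars ℝ ∘ₗ TensorProduct.mk ℝ ℂ _ 1
    obtain ⟨f₁, hf₁, hα₁⟩ := exists_contMDiff_mfderiv_eq x αre
    obtain ⟨f₂, hf₂, hα₂⟩ := exists_contMDiff_mfderiv_eq x αim
    have hf : ContMDiff 𝓘(ℝ, EX) 𝓘(ℝ, ℂ) ∞ (fun z => (f₁ z : ℂ) + (f₂ z : ℂ) * Complex.I) :=
      (contMDiff_ofReal hf₁).add (by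
        have := hf₂.smul (contMDiff_const (I' := 𝓘(ℝ, ℂ)) (c := Complex.I))
        exact this.congr fun z => (Complex.real_smul (x := f₂ z)).symm)
    refine ⟨_, hf, fun η hη => ⟨SmoothCFieldOn.smul hf hη, fun u => ?_⟩⟩
    have hα : ∀ a : CTangent EX x, α a =
        ((αre (complexRe _ a) - αim (complexIm _ a) : ℝ) : ℂ) +
          ((αre (complexIm _ a) + αim (complexRe _ a) : ℝ) : ℂ) * Complex.I := by
      intro a
      have : a = (1 : ℂ) ⊗ₜ complexRe _ a + Complex.I • ((1 : ℂ) ⊗ₜ[ℝ] complexIm _ a) := by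
        conv_lhs => rw [← one_tmul_complexRe_add a]
        simp [TensorProduct.smul_tmul']
      conv_lhs => rw [this, map_add, map_smul]
      refine Complex.ext ?_ ?_ <;> simp [αre, αim]
      · ring
      · ring
    have hre : ∀ z, ((f₁ z : ℂ) + (f₂ z : ℂ) * Complex.I).re = f₁ z := fun z => by simp
    have him : ∀ z, ((f₁ z : ℂ) + (f₂ z : ℂ) * Complex.I).im = f₂ z := fun z => by simp
    have hαre : (α (A.cOrbitDiff x u)).re = αre (A.orbitDiff x (complexRe _ u)) -
        αim (A.orbitDiff x (complexIm _ u)) := by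
      rw [hα, cOrbitDiff, complexRe_baseChange, complexIm_baseChange]
      simp
    have hαim : (α (A.cOrbitDiff x u)).im = αre (A.orbitDiff x (complexIm _ u)) +
        αim (A.orbitDiff x (complexRe _ u)) := by
      rw [hα, cOrbitDiff, complexRe_baseChange, complexIm_baseChange]
      simp
    refine complex_ext ?_ ?_
    · rw [complexRe_cLieAct, fieldRe_smul, fieldIm_smul, map_add, complexRe_smul, complexRe_smul,
        hαre, hαim, complexRe_cLieAct, complexIm_cLieAct]
      simp only [hre, him]
      rw [lieAct_sub (hη.1.smul hf₁) (hη.2.smul hf₂), lieAct_add (hη.2.smul hf₁) (hη.1.smul hf₂),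
        lieAct_smul hf₁ hη.1, lieAct_smul hf₂ hη.2, lieAct_smul hf₁ hη.2, lieAct_smul hf₂ hη.1]
      simp only [hα₁, hα₂, fieldRe, fieldIm]
      module
    · rw [complexIm_cLieAct, fieldRe_smul, fieldIm_smul, map_add, complexIm_smul, complexIm_smul,
        hαre, hαim, complexRe_cLieAct, complexIm_cLieAct]
      simp only [hre, him]
      rw [lieAct_sub (hη.1.smul hf₁) (hη.2.smul hf₂), lieAct_add (hη.2.smul hf₁) (hη.1.smul hf₂),
        lieAct_smul hf₁ hη.1, lieAct_smul hf₂ hη.2, lieAct_smul hf₁ hη.2, lieAct_smul hf₂ hη.1]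
      simp only [hα₁, hα₂, fieldRe, fieldIm]
      module

end LocalAction

/-! ### The theorem, assembled from the real and the complex bracket model. -/

theorem lemma2p1 {EG EX G X : Type*}
    [NormedAddCommGroup EG] [NormedSpace ℝ EG] [FiniteDimensional ℝ EG]
    [NormedAddCommGroup EX] [NormedSpace ℝ EX] [FiniteDimensional ℝ EX]
    [TopologicalSpace G] [ChartedSpace EG G] [Group G] [LieGroup 𝓘(ℝ, EG) ∞ G]
    [TopologicalSpace X] [T2Space X] [ChartedSpace EX X] [IsManifold 𝓘(ℝ, EX) ∞ X]
    (A : LocalAction EG EX G X) (hA : A.IsTransitive) (x : X) :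
    -- the subspaces corresponding to homogeneous subbundles are stable under the isotropy algebra
    (∀ E, A.IsHomogeneousSubbundle E →
      ∀ h ∈ A.isotropy x, ∀ u ∈ A.modelSubspace E x, ⁅h, u⁆ ∈ A.modelSubspace E x) ∧
    (∀ E, A.IsHomogeneousCSubbundle E →
      ∀ h ∈ A.cIsotropy x, ∀ u ∈ A.cModelSubspace E x, ⁅h, u⁆ ∈ A.cModelSubspace E x) ∧
    -- subbundles of the tangent bundle, one bracket
    (∀ E₁ E₂ D, A.IsHomogeneousSubbundle E₁ → A.IsHomogeneousSubbundle E₂ →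
      A.IsHomogeneousSubbundle D →
      IsBilinearMod (smoothFunctions EX X ℝ) (smoothSections EX E₁) (smoothSections EX E₂) D
        (mlieBracket 𝓘(ℝ, EX)) →
      ∃ b : ∀ y, E₁ y →ₗ[ℝ] E₂ y →ₗ[ℝ] (TangentSpace 𝓘(ℝ, EX) y ⧸ D y),
        (∀ b', IsInducedTensor (smoothSections EX E₁) (smoothSections EX E₂) E₁ E₂ D
          (mlieBracket 𝓘(ℝ, EX)) b' ↔ b' = b) ∧
        ((E₁ x = ⊥ → E₂ x ≤ D x) → (E₂ x = ⊥ → E₁ x ≤ D x) →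
        ∀ (ν₁ : E₁ x) (ν₂ : E₂ x), ∀ u₁ ∈ A.modelSubspace E₁ x, ∀ u₂ ∈ A.modelSubspace E₂ x,
          A.orbitDiff x u₁ = ν₁ → A.orbitDiff x u₂ = ν₂ →
          b x ν₁ ν₂ = A.modelQuot D x ((A.modelSubspace D x).mkQ ⁅u₁, u₂⁆))) ∧
    -- subbundles of the complexified tangent bundle, one bracket
    (∀ E₁ E₂ D, A.IsHomogeneousCSubbundle E₁ → A.IsHomogeneousCSubbundle E₂ →
      A.IsHomogeneousCSubbundle D →
      IsBilinearMod (smoothFunctions EX X ℂ) (smoothCSections EX E₁) (smoothCSections EX E₂) D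
        (cBracket EX) →
      ∃ b : ∀ y, E₁ y →ₗ[ℂ] E₂ y →ₗ[ℂ] (CTangent EX y ⧸ D y),
        (∀ b', IsInducedTensor (smoothCSections EX E₁) (smoothCSections EX E₂) E₁ E₂ D
          (cBracket EX) b' ↔ b' = b) ∧
        ((E₁ x = ⊥ → E₂ x ≤ D x) → (E₂ x = ⊥ → E₁ x ≤ D x) →
        ∀ (ν₁ : E₁ x) (ν₂ : E₂ x), ∀ u₁ ∈ A.cModelSubspace E₁ x, ∀ u₂ ∈ A.cModelSubspace E₂ x,
          A.cOrbitDiff x u₁ = ν₁ → A.cOrbitDiff x u₂ = ν₂ →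
          b x ν₁ ν₂ = A.cModelQuot D x ((A.cModelSubspace D x).mkQ ⁅u₁, u₂⁆))) ∧
    -- subbundles of the tangent bundle, linear combinations of brackets
    (∀ E₁ E₂ D, A.IsHomogeneousSubbundle E₁ → A.IsHomogeneousSubbundle E₂ →
      A.IsHomogeneousSubbundle D →
      ∀ (n : ℕ) (c : Fin n → ℝ)
        (P Q : Fin n → ∀ y, TangentSpace 𝓘(ℝ, EX) y →ₗ[ℝ] TangentSpace 𝓘(ℝ, EX) y),
      (∀ k, A.IsEquivariantHom E₁ (P k)) → (∀ k, A.IsEquivariantHom E₂ (Q k)) →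
      ∀ Φ : (∀ y, TangentSpace 𝓘(ℝ, EX) y) → (∀ y, TangentSpace 𝓘(ℝ, EX) y) →
          ∀ y : X, TangentSpace 𝓘(ℝ, EX) y,
      (∀ ξ η y, Φ ξ η y = ∑ k, c k •
        mlieBracket 𝓘(ℝ, EX) (fun z => P k z (ξ z)) (fun z => Q k z (η z)) y) →
      IsBilinearMod (smoothFunctions EX X ℝ) (smoothSections EX E₁) (smoothSections EX E₂) D Φ →
      ∃ b : ∀ y, E₁ y →ₗ[ℝ] E₂ y →ₗ[ℝ] (TangentSpace 𝓘(ℝ, EX) y ⧸ D y),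
        (∀ b', IsInducedTensor (smoothSections EX E₁) (smoothSections EX E₂) E₁ E₂ D Φ b' ↔
          b' = b) ∧
        ∀ σ : TangentSpace 𝓘(ℝ, EX) x →ₗ[ℝ] GroupLieAlgebra 𝓘(ℝ, EG) G,
          (∀ v, A.orbitDiff x (σ v) = v) →
          ∀ (ν₁ : E₁ x) (ν₂ : E₂ x),
            b x ν₁ ν₂ = A.modelQuot D x ((A.modelSubspace D x).mkQ
              (∑ k, c k • ⁅σ (P k x ν₁), σ (Q k x ν₂)⁆))) ∧
    -- subbundles of the complexified tangent bundle, linear combinations of brackets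
    (∀ E₁ E₂ D, A.IsHomogeneousCSubbundle E₁ → A.IsHomogeneousCSubbundle E₂ →
      A.IsHomogeneousCSubbundle D →
      ∀ (n : ℕ) (c : Fin n → ℂ) (P Q : Fin n → ∀ y, CTangent EX y →ₗ[ℂ] CTangent EX y),
      (∀ k, A.IsEquivariantCHom E₁ (P k)) → (∀ k, A.IsEquivariantCHom E₂ (Q k)) →
      ∀ Φ : (∀ y, CTangent EX y) → (∀ y, CTangent EX y) → ∀ y : X, CTangent EX y,
      (∀ ζ ϑ y, Φ ζ ϑ y = ∑ k, c k •
        cBracket EX (fun z => P k z (ζ z)) (fun z => Q k z (ϑ z)) y) →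
      IsBilinearMod (smoothFunctions EX X ℂ) (smoothCSections EX E₁) (smoothCSections EX E₂) D Φ →
      ∃ b : ∀ y, E₁ y →ₗ[ℂ] E₂ y →ₗ[ℂ] (CTangent EX y ⧸ D y),
        (∀ b', IsInducedTensor (smoothCSections EX E₁) (smoothCSections EX E₂) E₁ E₂ D Φ b' ↔
          b' = b) ∧
        ∀ σ : CTangent EX x →ₗ[ℂ] ℂ ⊗[ℝ] GroupLieAlgebra 𝓘(ℝ, EG) G,
          (∀ v, A.cOrbitDiff x (σ v) = v) →
          ∀ (ν₁ : E₁ x) (ν₂ : E₂ x),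
            b x ν₁ ν₂ = A.cModelQuot D x ((A.cModelSubspace D x).mkQ
              (∑ k, c k • ⁅σ (P k x ν₁), σ (Q k x ν₂)⁆))) := by
  have hV : ∀ y : X, FiniteDimensional ℝ (TangentSpace 𝓘(ℝ, EX) y) := fun _ =>
    inferInstanceAs (FiniteDimensional ℝ EX)
  have hVC : ∀ y : X, FiniteDimensional ℂ (CTangent EX y) := fun y =>
    inferInstanceAs (FiniteDimensional ℂ (ℂ ⊗[ℝ] TangentSpace 𝓘(ℝ, EX) y))
  have hB := LocalAction.isBracketModel hA x
  have hC := LocalAction.cIsBracketModel hA x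
  refine ⟨fun E hE h hh u hu => ?_, fun E hE h hh u hu => ?_,
    fun E₁ E₂ D h₁ h₂ hD hbil => ?_, fun E₁ E₂ D h₁ h₂ hD hbil => ?_,
    fun E₁ E₂ D h₁ h₂ hD n c P Q hP hQ Φ hΦ hbil => ?_,
    fun E₁ E₂ D h₁ h₂ hD n c P Q hP hQ Φ hΦ hbil => ?_⟩
  · exact hB.lie_mem (hasLocalFrames_smoothSections hE.1) (fun ξ hξ => hξ.1)
      (fun ξ hξ u => hE.lieAct_mem hξ u) hh hu
  · exact hC.lie_mem (hasLocalFrames_smoothCSections hE.1) (fun ξ hξ => hξ.1)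
      (fun ξ hξ u => hE.cLieAct_mem hξ u) (LocalAction.cOrbitDiff_eq_zero hh) hu
  · have f₁ := hasLocalFrames_smoothSections h₁.1
    have f₂ := hasLocalFrames_smoothSections h₂.1
    obtain ⟨b, hb⟩ := f₁.exists_inducedTensor f₂ hbil
    -- By definition `modelQuot` sends the class of `w` to the class of `π w`, so the abstract
    -- formula has the required form.
    exact ⟨b, hb, fun h₁₂ h₂₁ ν₁ ν₂ u₁ _ u₂ _ hu₁ hu₂ =>
      hB.bracket_tensor_eq f₁ f₂ (fun ξ hξ => hξ.1) (fun ξ hξ => hξ.1)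
        (fun ξ hξ u => h₁.lieAct_mem hξ u) (fun ξ hξ u => h₂.lieAct_mem hξ u) hbil
        ((hb b).2 rfl) h₁₂ h₂₁ ν₁ ν₂ hu₁ hu₂⟩
  · have f₁ := hasLocalFrames_smoothCSections h₁.1
    have f₂ := hasLocalFrames_smoothCSections h₂.1
    obtain ⟨b, hb⟩ := f₁.exists_inducedTensor f₂ hbil
    exact ⟨b, hb, fun h₁₂ h₂₁ ν₁ ν₂ u₁ _ u₂ _ hu₁ hu₂ =>
      hC.bracket_tensor_eq f₁ f₂ (fun ξ hξ => hξ.1) (fun ξ hξ => hξ.1)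
        (fun ξ hξ u => h₁.cLieAct_mem hξ u) (fun ξ hξ u => h₂.cLieAct_mem hξ u) hbil
        ((hb b).2 rfl) h₁₂ h₂₁ ν₁ ν₂ hu₁ hu₂⟩
  · have f₁ := hasLocalFrames_smoothSections h₁.1
    have f₂ := hasLocalFrames_smoothSections h₂.1
    obtain ⟨b, hb⟩ := f₁.exists_inducedTensor f₂ hbil
    exact ⟨b, hb, fun σ hσ ν₁ ν₂ =>
      hB.combination_eq f₁ f₂ (fun ξ hξ u => h₁.lieAct_mem hξ u)
        (fun ξ hξ u => h₂.lieAct_mem hξ u) (fun k => (hP k).1) (fun k => (hQ k).1)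
        (fun k ξ hξ u => (hP k).lieAct_eq h₁ hξ u) (fun k ξ hξ u => (hQ k).lieAct_eq h₂ hξ u)
        (fun ξ η => hΦ ξ η x) hbil ((hb b).2 rfl) hσ ν₁ ν₂⟩
  · have f₁ := hasLocalFrames_smoothCSections h₁.1
    have f₂ := hasLocalFrames_smoothCSections h₂.1
    obtain ⟨b, hb⟩ := f₁.exists_inducedTensor f₂ hbil
    exact ⟨b, hb, fun σ hσ ν₁ ν₂ =>
      hC.combination_eq f₁ f₂ (fun ξ hξ u => h₁.cLieAct_mem hξ u)
        (fun ξ hξ u => h₂.cLieAct_mem hξ u) (fun k => (hP k).1) (fun k => (hQ k).1)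
        (fun k ξ hξ u => (hP k).cLieAct_eq h₁ hξ u) (fun k ξ hξ u => (hQ k).cLieAct_eq h₂ hξ u)
        (fun ξ η => hΦ ξ η x) hbil ((hb b).2 rfl) hσ ν₁ ν₂⟩
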